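/- Let $\mathsf h$ be a complex Hilbert space of finite dimension $d$, and let $H_S$ be a self-adjoint operator on $\mathsf h$ with distinct eigenvalues $\varepsilon_n$ and spectral projections $P_{\varepsilon_n}$. The Bohr frequencies are the numbers $\omega=\varepsilon_n-\varepsilon_m$ with $\varepsilon_n>\varepsilon_m$; enumerate them as $\omega_1,\dots,\omega_b$. Let $V$ be an operator on $\mathsf h$ and, for each Bohr frequency $\omega$, let $$V_\omega=\sum_{\varepsilon_n-\varepsilon_m=\omega}P_{\varepsilon_m}VP_{\varepsilon_n},$$ let $H_\omega$ be a self-adjoint operator commuting with $H_S$, and let $\gamma^-_\omega,\gamma^+_\omega>0$. Let $\mathcal T_t=e^{t\mathcal L}$ be the quantum Markov semigroup on $\mathcal B(\mathsf h)$ with generator $\mathcal L=\sum_\omega\mathcal L_\omega$, where $$\mathcal L_\omega(x)=\mathrm i[H_\omega,x]-\tfrac{\gamma^-_\omega}{2}\left(V_\omega^*V_\omega x-2V_\omega^*xV_\omega+xV_\omega^*V_\omega\right)-\tfrac{\gamma^+_\omega}{2}\left(V_\omega V_\omega^*x-2V_\omega xV_\omega^*+xV_\omega V_\omega^*\right),$$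 and put $L_{2\ell}=(\gamma^-_{\omega_\ell})^{1/2}V_{\omega_\ell}$ and $L_{2\ell-1}=(\gamma^+_{\omega_\ell})^{1/2}V_{\omega_\ell}^*$ for $1\le\ell\le b$. Let $(e_j)_{1\le j\le d}$ be an orthonormal basis of $\mathsf h$ consisting of eigenvectors of $H_S$, let $\rho=\sum_j\rho_j|e_j\rangle\langle e_j|$ with $\rho_j>0$ and $\sum_j\rho_j=1$ be an invariant state of $\mathcal T$, i.e. $\mathrm{tr}(\rho\,\mathcal T_t(x))=\mathrm{tr}(\rho x)$ for all $t\ge0$ and $x\in\mathcal B(\mathsf h)$, and let $\Theta(x)=x^{\intercal}$ be the transposition with respect to $(e_j)$. The entropy production is $$\mathrm{ep}(\mathcal T,\rho)=\limsup_{t\to0^+}\frac{S(\overrightarrow\Omega_t,\overleftarrow\Omega_t)}{t}\in[0,+\infty],$$ where $\overrightarrow\Omega_t$ and $\overleftarrow\Omega_t$ are the states on $\mathcal B(\mathsf h)\otimes\mathcal B(\mathsf h)$ given by $$\overrightarrow\Omega_t(x\otimes y)=\mathrm{tr}\big(\rho^{1/2}x^{\intercal}\rho^{1/2}\mathcal T_t(y)\big),\qquad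 \overleftarrow\Omega_t(x\otimes y)=\mathrm{tr}\big(\rho^{1/2}\mathcal T_t(x)^{\intercal}\rho^{1/2}y\big),$$ and $S$ is the quantum relative entropy: $S=\mathrm{Tr}\,A(\log A-\log B)$ for states with densities $A,B$ if the support of $A$ is contained in that of $B$, and $S=+\infty$ otherwise. The standard quantum detailed balance condition with reversing operation $\Theta$ (SQDB-$\Theta$) says that the dual maps $\mathcal T'_t$ defined by $\mathrm{tr}(\rho^{1/2}x\rho^{1/2}\mathcal T_t(y))=\mathrm{tr}(\rho^{1/2}\mathcal T'_t(x)\rho^{1/2}y)$ for all $x,y\in\mathcal B(\mathsf h)$ satisfy $\mathcal T'_t=\Theta\circ\mathcal T_t\circ\Theta$ for all $t\ge0$. **Theorem.** Assume that, for every Bohr frequency $\omega$, the operators $V_\omega$ and $H_\omega$ are represented by real matrices in the basis $(e_j)$. Then the following are equivalent: 1. the entropy production $\mathrm{ep}(\mathcal T,\rho)$ is zero; 2. $\rho^{1/2}L_{2\ell-1}^*=L_{2\ell}\,\rho^{1/2}$ for all $\ell=1,\dots,b$; 3. $(\gamma^+_\omega)^{1/2}\rho^{1/2}V_\omega=(\gamma^-_\omega)^{1/2}V_\omega\rho^{1/2}$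 for all Bohr frequencies $\omega$; 4. the SQDB-$\Theta$ condition holds. -/

import Mathlib

open Filter Topology
open scoped InnerProductSpace

namespace StochLimit

noncomputable section

/-- The semigroup `t ↦ exp (t L)` generated by a bounded operator `L` on a Banach space. -/
def expSemigroup {B : Type*} [NormedAddCommGroup B] [NormedSpace ℂ B] (L : B →L[ℂ] B) (t : ℝ) :
    B →L[ℂ] B :=
  NormedSpace.exp ((t : ℂ) • L)

section Generator

variable {E : Type*} [NormedAddCommGroup E] [InnerProductSpace ℂ E] [FiniteDimensional ℂ E]

/-- The (unnormalised) trace of an operator on a finite-dimensional Hilbert space. -/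
def tr (x : E →L[ℂ] E) : ℂ := LinearMap.trace ℂ E (x : E →ₗ[ℂ] E)

theorem finite_energyLevels (HS : E →L[ℂ] E) :
    {c : ℝ | Module.End.HasEigenvalue (HS : E →ₗ[ℂ] E) (c : ℂ)}.Finite :=
  Set.Finite.preimage (f := fun c : ℝ => (c : ℂ))
    Complex.ofReal_injective.injOn (Module.End.finite_hasEigenvalue (HS : E →ₗ[ℂ] E))

/-- The distinct (real) eigenvalues of the system Hamiltonian. -/
def energyLevels (HS : E →L[ℂ] E) : Finset ℝ := (finite_energyLevels HS).toFinset

/-- The spectral projection onto the nullspace of `HS - c`. -/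
def spectralProj (HS : E →L[ℂ] E) (c : ℝ) : E →L[ℂ] E :=
  (Module.End.eigenspace (HS : E →ₗ[ℂ] E) (c : ℂ)).starProjection

/-- The Bohr frequencies: the strictly positive differences of two eigenvalues. -/
def bohrFrequencies (HS : E →L[ℂ] E) : Finset ℝ :=
  ((energyLevels HS ×ˢ energyLevels HS).filter (fun q => q.2 < q.1)).image
    (fun q => q.1 - q.2)

/-- `V_ω`, the sum of `P_{c'} V P_c` over all pairs of eigenvalues with `c - c' = ω`. -/
def bohrComponent (HS V : E →L[ℂ] E) (ω : ℝ) : E →L[ℂ] E :=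
  ∑ q ∈ (energyLevels HS ×ˢ energyLevels HS).filter (fun q => q.1 - q.2 = ω),
    spectralProj HS q.2 * V * spectralProj HS q.1

variable [CompleteSpace E]

/-- The GKSL generator with Hamiltonian `H` and the two Kraus operators
`√gm • W` and `√gp • star W`. -/
def gksl (H W : E →L[ℂ] E) (gm gp : ℝ) : (E →L[ℂ] E) →ₗ[ℂ] (E →L[ℂ] E) where
  toFun x := Complex.I • (H * x - x * H)
    - ((gm : ℂ) / 2) • (star W * W * x - (2 : ℂ) • (star W * x * W) + x * (star W * W))
    - ((gp : ℂ) / 2) • (W * star W * x - (2 : ℂ) • (W * x * star W) + x * (W * star W))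
  map_add' x y := by
    simp only [mul_add, add_mul]
    module
  map_smul' c x := by
    simp only [mul_smul_comm, smul_mul_assoc, RingHom.id_apply]
    module

/-- The generator `ℒ = ∑_ω ℒ_ω`, the sum running over the Bohr frequencies of `HS`. -/
def generator (HS V : E →L[ℂ] E) (H : ℝ → E →L[ℂ] E) (gm gp : ℝ → ℝ) :
    (E →L[ℂ] E) →ₗ[ℂ] (E →L[ℂ] E) :=
  ∑ ω ∈ bohrFrequencies HS, gksl (H ω) (bohrComponent HS V ω) (gm ω) (gp ω)

/-- The semigroup `t ↦ exp (t ℒ)` on `B(E)` generated by `ℒ`. -/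
def semigroup (L : (E →L[ℂ] E) →ₗ[ℂ] (E →L[ℂ] E)) (t : ℝ) :
    (E →L[ℂ] E) →L[ℂ] (E →L[ℂ] E) :=
  expSemigroup (LinearMap.toContinuousLinearMap L) t

/-- `ρ` is an invariant state of the semigroup `T` (in the Heisenberg picture). -/
def IsInvariantState (T : ℝ → (E →L[ℂ] E) →L[ℂ] (E →L[ℂ] E)) (ρ : E →L[ℂ] E) : Prop :=
  ∀ t : ℝ, 0 ≤ t → ∀ x : E →L[ℂ] E, tr (ρ * T t x) = tr (ρ * x)

/-- The Kraus operators `L_n`, `n = 1, …, 2b`, for an enumeration `ω 1, …, ω b` of the Bohr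
frequencies: `L_{2ℓ} = √γ⁻ • V_ω` and `L_{2ℓ-1} = √γ⁺ • V_ω^*` with `ω = ω ℓ`. -/
def krausOp (HS V : E →L[ℂ] E) (gm gp : ℝ → ℝ) (ω : ℕ → ℝ) (n : ℕ) : E →L[ℂ] E :=
  if Even n then
    ((√(gm (ω (n / 2))) : ℝ) : ℂ) • bohrComponent HS V (ω (n / 2))
  else
    ((√(gp (ω ((n + 1) / 2))) : ℝ) : ℂ) • star (bohrComponent HS V (ω ((n + 1) / 2)))

end Generator

section Transpose

variable {E : Type*} [NormedAddCommGroup E] [InnerProductSpace ℂ E] [FiniteDimensional ℂ E]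
  {d : ℕ}

/-- The operator is represented by a real matrix in the orthonormal basis `e`. -/
def IsRealMatrix (e : OrthonormalBasis (Fin d) ℂ E) (x : E →L[ℂ] E) : Prop :=
  ∀ i j : Fin d, (⟪e i, x (e j)⟫_ℂ).im = 0

/-- The reversing operation `Θ`: transposition in the orthonormal basis `e`. -/
def transposeOp (e : OrthonormalBasis (Fin d) ℂ E) (x : E →L[ℂ] E) : E →L[ℂ] E :=
  LinearMap.toContinuousLinearMap (Matrix.toLin e.toBasis e.toBasis
    (LinearMap.toMatrix e.toBasis e.toBasis (x : E →ₗ[ℂ] E)).transpose)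

variable [CompleteSpace E]

/-- `T'` is the dual of `T` for the bilinear form `(x, y) ↦ tr (ρ^{1/2} x ρ^{1/2} y)`. -/
def IsStandardDual (ρ : E →L[ℂ] E) (T T' : ℝ → (E →L[ℂ] E) →L[ℂ] (E →L[ℂ] E)) : Prop :=
  ∀ t : ℝ, 0 ≤ t → ∀ x y : E →L[ℂ] E,
    tr (CFC.sqrt ρ * x * CFC.sqrt ρ * T t y) = tr (CFC.sqrt ρ * T' t x * CFC.sqrt ρ * y)

/-- The standard quantum detailed balance condition with respect to the reversing operation `Θ`:
the dual semigroup `T'` of `T` satisfies `T'_t = Θ ∘ T_t ∘ Θ` for all `t ≥ 0`. -/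
def SQDBTheta (e : OrthonormalBasis (Fin d) ℂ E) (ρ : E →L[ℂ] E)
    (T : ℝ → (E →L[ℂ] E) →L[ℂ] (E →L[ℂ] E)) : Prop :=
  ∃ T' : ℝ → (E →L[ℂ] E) →L[ℂ] (E →L[ℂ] E), IsStandardDual ρ T T' ∧
    ∀ t : ℝ, 0 ≤ t → ∀ x : E →L[ℂ] E, T' t x = transposeOp e (T t (transposeOp e x))

/-- The forward two-point state, on elementary tensors `x ⊗ y`. -/
def forwardState (e : OrthonormalBasis (Fin d) ℂ E) (ρ : E →L[ℂ] E)
    (T : ℝ → (E →L[ℂ] E) →L[ℂ] (E →L[ℂ] E)) (t : ℝ) (x y : E →L[ℂ] E) : ℂ :=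
  tr (CFC.sqrt ρ * transposeOp e x * CFC.sqrt ρ * T t y)

/-- The backward two-point state, on elementary tensors `x ⊗ y`. -/
def backwardState (e : OrthonormalBasis (Fin d) ℂ E) (ρ : E →L[ℂ] E)
    (T : ℝ → (E →L[ℂ] E) →L[ℂ] (E →L[ℂ] E)) (t : ℝ) (x y : E →L[ℂ] E) : ℂ :=
  tr (CFC.sqrt ρ * transposeOp e (T t x) * CFC.sqrt ρ * y)

/-- The density matrix `D`, in the orthonormal basis `e i ⊗ e k` of `E ⊗ E`, of a functional `Ω`
on `B(E) ⊗ B(E)` given on elementary tensors; that is, `Ω (x ⊗ y) = Tr (D (x ⊗ y))`. With the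
matrix units `E_{ij} = |e i⟩⟨e j|`, its `((i,k),(j,l))` entry is `Ω (E_{ji} ⊗ E_{lk})`. -/
def densityMatrix (e : OrthonormalBasis (Fin d) ℂ E)
    (Ω : (E →L[ℂ] E) → (E →L[ℂ] E) → ℂ) : Matrix (Fin d × Fin d) (Fin d × Fin d) ℂ :=
  Matrix.of fun a b => Ω (InnerProductSpace.rankOne ℂ (e b.1) (e a.1))
    (InnerProductSpace.rankOne ℂ (e b.2) (e a.2))

end Transpose

/-- The quantum relative entropy `S(A, B) = Tr A (log A - log B)` of two density matrices, equal
to `+∞` unless the support of `A` is contained in that of `B`, i.e. `ker B ⊆ ker A`.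
(The functional calculus with `Real.log 0 = 0` gives the logarithm on the support.) -/
def relEntropy {n : Type*} [Fintype n] [DecidableEq n] (A B : Matrix n n ℂ) : EReal :=
  open Classical in
  if ∀ v : n → ℂ, B.mulVec v = 0 → A.mulVec v = 0 then
    (((A * (cfc Real.log A - cfc Real.log B)).trace.re : ℝ) : EReal)
  else ⊤

/-- The entropy production rate: the upper limit, as `t → 0+`, of `1/t` times the relative entropy
of the forward with respect to the backward two-point state. It takes values in `[0, +∞]`. -/
def entropyProduction {E : Type*} [NormedAddCommGroup E] [InnerProductSpace ℂ E]
    [FiniteDimensional ℂ E] [CompleteSpace E] {d : ℕ} (e : OrthonormalBasis (Fin d) ℂ E)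
    (ρ : E →L[ℂ] E) (T : ℝ → (E →L[ℂ] E) →L[ℂ] (E →L[ℂ] E)) : EReal :=
  limsup (fun t : ℝ =>
    relEntropy (densityMatrix e (forwardState e ρ T t))
      (densityMatrix e (backwardState e ρ T t)) / (t : EReal)) (𝓝[>] (0 : ℝ))

end

end StochLimit

open StochLimit

/-! Write β(x, y) = tr(ρ^{1/2} x^⊺ ρ^{1/2} y). This form is symmetric, the forward state is β(x, T_t
y) and the backward state is β(T_t x, y). Hence SQDB-Θ says exactly that the two states agree for
all t ≥ 0, and then their relative entropy is zero (4 → 1).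

For 3 → 4 it is enough that ℒ is symmetric for β. Reality turns transposition into the adjoint, so
the balance relation exchanges the jump terms of V_ω and V_ω^* and makes V_ω^* V_ω and V_ω V_ω^*
commute with ρ^{1/2}. Invariance of ρ then forces the total Hamiltonian to commute with ρ
(`twoPoint_generator_symm`).

For 1 → 3, the relative entropy dominates (√A_vv - √B_vv)² for each diagonal entry of the two
density matrices (`sq_sqrt_diag_sub_le_trace_log`). At v = (i, k) with i ≠ k, these entries vanish
at t = 0 and have slopes p_i r_{ik} and p_k r_{ki}, where r denotes the transition rates. Entropy
o(t) forces the slopes to agree (`eq_of_sq_sqrt_sub_sqrt_le`). When ε_i - ε_k = ω, only V_ω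
contributes, giving p_i γ⁻_ω = p_k γ⁺_ω wherever V_ω has a nonzero entry: this is 3 read entrywise.
The entropy bound needs positive semidefinite density matrices, hence complete positivity of the
semigroup. -/

namespace StochLimit

/-! ### Lower bounds for the relative entropy -/

section RelativeEntropy

open scoped ComplexOrder

/-- For positive a and b this is log u ≤ u - 1 at u = √b / √a, multiplied by 2a. The implication
`hab` excludes the one case in which `Real.log 0 = 0` would break the bound. -/
theorem sq_sqrt_sub_sqrt_le_mul_log {a b : ℝ} (ha : 0 ≤ a) (hb : 0 ≤ b) (hab : b = 0 → a = 0) :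
    (√a - √b) ^ 2 ≤ a * Real.log a - a * Real.log b - a + b := by
  rcases ha.eq_or_lt with rfl | ha
  · simp [Real.sq_sqrt hb]
  rcases hb.eq_or_lt with rfl | hb
  · exact absurd (hab rfl) ha.ne'
  have hsa := Real.sqrt_pos.2 ha
  have hsb := Real.sqrt_pos.2 hb
  have h := Real.log_le_sub_one_of_pos (div_pos hsb hsa)
  rw [Real.log_div hsb.ne' hsa.ne', Real.log_sqrt hb.le, Real.log_sqrt ha.le] at h
  have h2 := mul_le_mul_of_nonneg_left h (mul_pos two_pos ha).le
  have e : 2 * a * (√b / √a - 1) = 2 * (√a * √b) - 2 * a := by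
    nth_rw 1 [← Real.mul_self_sqrt ha.le]
    field_simp
    rw [mul_sub, Real.mul_self_sqrt ha.le]
  have := Real.sq_sqrt ha.le
  have := Real.sq_sqrt hb.le
  nlinarith

variable {n : Type*} [Fintype n] [DecidableEq n]

/-- The squared modulus of the overlap of two eigenvectors. -/
noncomputable def eigenOverlap {A B : Matrix n n ℂ} (hA : A.IsHermitian) (hB : B.IsHermitian)
    (i j : n) : ℝ :=
  ‖((star hA.eigenvectorUnitary : Matrix n n ℂ) * (hB.eigenvectorUnitary : Matrix n n ℂ)) i j‖ ^ 2

/-- Expanding in the two eigenbases gives nonnegative weights independent of f and g, so trace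
inequalities reduce to scalar ones. -/
theorem trace_cfc_mul_cfc {A B : Matrix n n ℂ} (hA : A.IsHermitian) (hB : B.IsHermitian)
    (f g : ℝ → ℝ) :
    (cfc f A * cfc g B).trace.re =
      ∑ i, ∑ j, f (hA.eigenvalues i) * g (hB.eigenvalues j) * eigenOverlap hA hB i j := by
  rw [hA.cfc_eq, hB.cfc_eq, Matrix.IsHermitian.cfc, Matrix.IsHermitian.cfc,
    Unitary.conjStarAlgAut_apply, Unitary.conjStarAlgAut_apply]
  set U : Matrix n n ℂ := (hA.eigenvectorUnitary : Matrix n n ℂ) with hU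
  set W : Matrix n n ℂ := (hB.eigenvectorUnitary : Matrix n n ℂ) with hW
  set D := Matrix.diagonal (RCLike.ofReal (K := ℂ) ∘ f ∘ hA.eigenvalues)
  set D' := Matrix.diagonal (RCLike.ofReal (K := ℂ) ∘ g ∘ hB.eigenvalues)
  have e1 : (U * D * star U * (W * D' * star W)).trace
      = (D * (star U * W) * (D' * star (star U * W))).trace := by
    rw [star_mul, star_star, mul_assoc U, mul_assoc U, Matrix.trace_mul_comm U]
    simp only [mul_assoc]
  rw [e1, Matrix.trace, Complex.re_sum]
  refine Finset.sum_congr rfl fun i _ => ?_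
  rw [Matrix.diag_apply, Matrix.mul_apply, Complex.re_sum]
  refine Finset.sum_congr rfl fun j _ => ?_
  simp only [D, D', Matrix.diagonal_mul, Matrix.star_apply, eigenOverlap, Function.comp]
  change ((((f _ : ℝ) : ℂ) * ((star U * W) i j)) * (((g _ : ℝ) : ℂ) * star ((star U * W) i j))).re = _
  have : ∀ (x y : ℝ) (z : ℂ), ((x : ℂ) * z * ((y : ℂ) * star z)).re = x * y * ‖z‖ ^ 2 := by
    intro x y z
    have h : (x : ℂ) * z * ((y : ℂ) * star z) = ((x * y * ‖z‖ ^ 2 : ℝ) : ℂ) := by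
      have := Complex.mul_conj' z
      push_cast
      rw [← this]
      simp only [RCLike.star_def]
      ring
    rw [h, Complex.ofReal_re]
  exact this _ _ _

theorem continuousOn_spectrum_matrix (A : Matrix n n ℂ) (f : ℝ → ℝ) :
    ContinuousOn f (spectrum ℝ A) :=
  (Matrix.finite_real_spectrum (A := A)).continuousOn f

/-- A null vector of B is a null vector of A, hence orthogonal to the eigenvectors of A with nonzero
eigenvalue. This disposes of the pairs for which the scalar inequality is unavailable. -/
theorem eigenvalue_mul_eigenOverlap_eq_zero {A B : Matrix n n ℂ} (hA : A.IsHermitian)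
    (hB : B.IsHermitian) (hker : ∀ v : n → ℂ, B.mulVec v = 0 → A.mulVec v = 0) {i j : n}
    (hj : hB.eigenvalues j = 0) (hi : hA.eigenvalues i ≠ 0) : eigenOverlap hA hB i j = 0 := by
  have h1 : A.mulVec (hB.eigenvectorBasis j) = 0 := by
    apply hker
    rw [hB.mulVec_eigenvectorBasis, hj]
    simp
  have h2 : (star (hA.eigenvectorUnitary : Matrix n n ℂ) * A *
      (hB.eigenvectorUnitary : Matrix n n ℂ)) i j = 0 := by
    rw [mul_assoc]
    have : ∀ k, (A * (hB.eigenvectorUnitary : Matrix n n ℂ)) k j = 0 := fun k => congrFun h1 k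
    rw [Matrix.mul_apply]
    simp [this]
  have h3 : star (hA.eigenvectorUnitary : Matrix n n ℂ) * A =
      Matrix.diagonal (RCLike.ofReal (K := ℂ) ∘ hA.eigenvalues) *
        star (hA.eigenvectorUnitary : Matrix n n ℂ) := by
    refine (congrArg (star (hA.eigenvectorUnitary : Matrix n n ℂ) * ·) hA.spectral_theorem).trans ?_
    rw [Unitary.conjStarAlgAut_apply, ← mul_assoc, ← mul_assoc]
    simp
  rw [h3, mul_assoc, Matrix.diagonal_mul] at h2
  have : (star (hA.eigenvectorUnitary : Matrix n n ℂ) *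
      (hB.eigenvectorUnitary : Matrix n n ℂ)) i j = 0 := by
    rcases mul_eq_zero.1 h2 with h | h
    · exact absurd (by simpa using h) hi
    · exact h
  simp only [eigenOverlap]
  simpa using this

/-- The relative entropy dominates the squared Hilbert-Schmidt distance of the square roots. -/
theorem trace_sq_cfc_sqrt_sub_le {A B : Matrix n n ℂ} (hA : A.PosSemidef) (hB : B.PosSemidef)
    (htr : A.trace = B.trace) (hker : ∀ v : n → ℂ, B.mulVec v = 0 → A.mulVec v = 0) :
    ((cfc Real.sqrt A - cfc Real.sqrt B) * (cfc Real.sqrt A - cfc Real.sqrt B)).trace.re ≤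
      (A * (cfc Real.log A - cfc Real.log B)).trace.re := by
  have hA1 := hA.isHermitian
  have hB1 := hB.isHermitian
  have sA : IsSelfAdjoint A := hA1
  have sB : IsSelfAdjoint B := hB1
  have T := trace_cfc_mul_cfc hA1 hB1
  have oneA : cfc (fun _ : ℝ => (1 : ℝ)) A = 1 := cfc_const_one ℝ A
  have oneB : cfc (fun _ : ℝ => (1 : ℝ)) B = 1 := cfc_const_one ℝ B
  have idA : cfc (fun x : ℝ => x) A = A := cfc_id' ℝ A
  have idB : cfc (fun x : ℝ => x) B = B := cfc_id' ℝ B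
  have nnA : ∀ x ∈ spectrum ℝ A, 0 ≤ x := by
    intro x hx
    rw [hA1.spectrum_real_eq_range_eigenvalues] at hx
    obtain ⟨i, rfl⟩ := hx
    exact hA.eigenvalues_nonneg i
  have nnB : ∀ x ∈ spectrum ℝ B, 0 ≤ x := by
    intro x hx
    rw [hB1.spectrum_real_eq_range_eigenvalues] at hx
    obtain ⟨i, rfl⟩ := hx
    exact hB.eigenvalues_nonneg i
  have sqA : cfc Real.sqrt A * cfc Real.sqrt A = A := by
    rw [← cfc_mul Real.sqrt Real.sqrt A (continuousOn_spectrum_matrix _ _)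
      (continuousOn_spectrum_matrix _ _)]
    conv_rhs => rw [← idA]
    exact cfc_congr fun x hx => Real.mul_self_sqrt (nnA x hx)
  have sqB : cfc Real.sqrt B * cfc Real.sqrt B = B := by
    rw [← cfc_mul Real.sqrt Real.sqrt B (continuousOn_spectrum_matrix _ _)
      (continuousOn_spectrum_matrix _ _)]
    conv_rhs => rw [← idB]
    exact cfc_congr fun x hx => Real.mul_self_sqrt (nnB x hx)
  have logA : A * cfc Real.log A = cfc (fun x => x * Real.log x) A := by
    rw [cfc_mul (fun x => x) Real.log A (continuousOn_spectrum_matrix _ _)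
      (continuousOn_spectrum_matrix _ _), idA]
  have t1 := T (fun x => x * Real.log x) (fun _ => 1)
  have t2 := T (fun x => x) Real.log
  have t3 := T (fun x => x) (fun _ => 1)
  have t4 := T (fun _ => 1) (fun x => x)
  have t5 := T Real.sqrt Real.sqrt
  rw [oneB, mul_one, ← logA] at t1
  rw [idA] at t2
  rw [oneB, idA, mul_one] at t3
  rw [oneA, idB, one_mul] at t4
  have lhs : ((cfc Real.sqrt A - cfc Real.sqrt B) * (cfc Real.sqrt A - cfc Real.sqrt B)).trace.re
      = A.trace.re + B.trace.re - 2 * (cfc Real.sqrt A * cfc Real.sqrt B).trace.re := by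
    rw [sub_mul, mul_sub, mul_sub, sqA, sqB]
    simp only [Matrix.trace_sub, Complex.sub_re]
    rw [Matrix.trace_mul_comm (cfc Real.sqrt B)]
    ring
  -- Since the traces agree, the terms -a + b of the scalar inequality can be inserted at no cost.
  have rhs : (A * (cfc Real.log A - cfc Real.log B)).trace.re
      = (A * cfc Real.log A).trace.re - (A * cfc Real.log B).trace.re - A.trace.re
        + B.trace.re := by
    rw [mul_sub, Matrix.trace_sub, Complex.sub_re, htr]
    ring
  rw [lhs, rhs, t1, t2, t3, t4, t5]
  simp only [Finset.mul_sum, ← Finset.sum_add_distrib, ← Finset.sum_sub_distrib]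
  refine Finset.sum_le_sum fun i _ => Finset.sum_le_sum fun j _ => ?_
  have w0 : 0 ≤ eigenOverlap hA1 hB1 i j := sq_nonneg _
  by_cases hc : hB1.eigenvalues j = 0 → hA1.eigenvalues i = 0
  · have h := mul_le_mul_of_nonneg_right (sq_sqrt_sub_sqrt_le_mul_log (hA.eigenvalues_nonneg i)
      (hB.eigenvalues_nonneg j) hc) w0
    rw [sub_sq, Real.sq_sqrt (hA.eigenvalues_nonneg i), Real.sq_sqrt (hB.eigenvalues_nonneg j)] at h
    linarith
  · push Not at hc
    rw [eigenvalue_mul_eigenOverlap_eq_zero hA1 hB1 hker hc.1 hc.2]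
    simp

theorem re_apply_self_eq_norm_sq {A : Matrix n n ℂ} (hA : A.PosSemidef) (v : n) :
    (A v v).re = ‖WithLp.toLp 2 ((cfc Real.sqrt A).col v)‖ ^ 2 := by
  have hA1 := hA.isHermitian
  have sA : IsSelfAdjoint A := hA1
  have nnA : ∀ x ∈ spectrum ℝ A, 0 ≤ x := by
    intro x hx
    rw [hA1.spectrum_real_eq_range_eigenvalues] at hx
    obtain ⟨i, rfl⟩ := hx
    exact hA.eigenvalues_nonneg i
  have sqA : cfc Real.sqrt A * cfc Real.sqrt A = A := by
    rw [← cfc_mul Real.sqrt Real.sqrt A (continuousOn_spectrum_matrix _ _)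
      (continuousOn_spectrum_matrix _ _)]
    conv_rhs => rw [← cfc_id' ℝ A]
    exact cfc_congr fun x hx => Real.mul_self_sqrt (nnA x hx)
  have hs : star (cfc Real.sqrt A) = cfc Real.sqrt A := (cfc_predicate Real.sqrt A : _)
  have sqA' : A = star (cfc Real.sqrt A) * cfc Real.sqrt A := by rw [hs, sqA]
  conv_lhs => rw [sqA']
  rw [Matrix.mul_apply, Complex.re_sum, EuclideanSpace.norm_sq_eq]
  refine Finset.sum_congr rfl fun k _ => ?_
  simp only [Matrix.star_apply, RCLike.star_def, Matrix.col_apply]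
  rw [Complex.conj_mul', ← Complex.ofReal_pow, Complex.ofReal_re]

/-- A diagonal entry is the squared norm of a column of the square root. The reverse triangle
inequality applies to column v, which contributes one summand of the Hilbert-Schmidt distance. -/
theorem sq_sqrt_diag_sub_le_trace_log {A B : Matrix n n ℂ} (hA : A.PosSemidef)
    (hB : B.PosSemidef) (htr : A.trace = B.trace)
    (hker : ∀ v : n → ℂ, B.mulVec v = 0 → A.mulVec v = 0) (v : n) :
    (√(A v v).re - √(B v v).re) ^ 2 ≤ (A * (cfc Real.log A - cfc Real.log B)).trace.re := by
  refine le_trans ?_ (trace_sq_cfc_sqrt_sub_le hA hB htr hker)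
  rw [re_apply_self_eq_norm_sq hA, re_apply_self_eq_norm_sq hB, Real.sqrt_sq (norm_nonneg _),
    Real.sqrt_sq (norm_nonneg _)]
  have h1 := abs_norm_sub_norm_le (WithLp.toLp 2 ((cfc Real.sqrt A).col v))
    (WithLp.toLp 2 ((cfc Real.sqrt B).col v))
  refine (sq_le_sq.2 (by rwa [abs_norm])).trans (b := ‖WithLp.toLp 2 ((cfc Real.sqrt A).col v)
    - WithLp.toLp 2 ((cfc Real.sqrt B).col v)‖ ^ 2) ?_
  set X := cfc Real.sqrt A - cfc Real.sqrt B with hX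
  have hs : star X = X := by
    have e1 : star (cfc Real.sqrt A) = cfc Real.sqrt A := (cfc_predicate Real.sqrt A : _)
    have e2 : star (cfc Real.sqrt B) = cfc Real.sqrt B := (cfc_predicate Real.sqrt B : _)
    rw [hX, star_sub, e1, e2]
  have hcol : ∀ w, ((X * X) w w).re = ∑ k, ‖X k w‖ ^ 2 := by
    intro w
    have hXX : X * X = star X * X := by rw [hs]
    rw [hXX]
    rw [Matrix.mul_apply, Complex.re_sum]
    refine Finset.sum_congr rfl fun k _ => ?_
    simp only [Matrix.star_apply, RCLike.star_def]
    rw [Complex.conj_mul', ← Complex.ofReal_pow, Complex.ofReal_re]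
  rw [EuclideanSpace.norm_sq_eq, Matrix.trace, Complex.re_sum]
  refine le_trans (le_of_eq ?_) (Finset.single_le_sum (f := fun w => ((X * X) w w).re)
    (fun w _ => ?_) (Finset.mem_univ v))
  · rw [hcol]
    rfl
  · rw [hcol]
    positivity

end RelativeEntropy

/-! ### Exponentials as limits of powers -/

section ProductFormula

/-- Telescoping. The hypothesis ‖1‖ ≤ 1, rather than equality, also covers the zero ring. -/
theorem norm_pow_sub_pow_le_mul {𝔸 : Type*} [NormedRing 𝔸] {a b : 𝔸} {M : ℝ} (h1 : ‖(1 : 𝔸)‖ ≤ 1)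
    (hM : 1 ≤ M) (ha : ‖a‖ ≤ M) (hb : ‖b‖ ≤ M) (n : ℕ) :
    ‖a ^ n - b ^ n‖ ≤ n * M ^ n * ‖a - b‖ := by
  have hM0 : 0 ≤ M := zero_le_one.trans hM
  have hbn : ∀ k : ℕ, ‖b ^ k‖ ≤ M ^ k := by
    intro k
    induction k with
    | zero => simpa using h1
    | succ k ih =>
      rw [pow_succ, pow_succ]
      exact (norm_mul_le _ _).trans (mul_le_mul ih hb (norm_nonneg _) (by positivity))
  induction n with
  | zero => simp
  | succ n ih =>
    have e : a ^ (n + 1) - b ^ (n + 1) = (a ^ n - b ^ n) * a + b ^ n * (a - b) := by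
      rw [pow_succ, pow_succ]; noncomm_ring
    rw [e]
    calc ‖(a ^ n - b ^ n) * a + b ^ n * (a - b)‖
        ≤ ‖a ^ n - b ^ n‖ * ‖a‖ + ‖b ^ n‖ * ‖a - b‖ :=
          (norm_add_le _ _).trans (add_le_add (norm_mul_le _ _) (norm_mul_le _ _))
      _ ≤ (n * M ^ n * ‖a - b‖) * M + M ^ n * M * ‖a - b‖ := by
          refine add_le_add (mul_le_mul ih ha (norm_nonneg _) (by positivity))
            (mul_le_mul_of_nonneg_right ((hbn n).trans ?_) (norm_nonneg _))
          exact le_mul_of_one_le_right (by positivity) hM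
      _ = _ := by push_cast; ring

variable {𝔸 : Type*} [NormedRing 𝔸] [NormedAlgebra ℝ 𝔸]

/-- The exponential form makes the (n+1)-st power at s = 1/(n+1) bounded by exp (‖A‖ + 1), uniformly
in n. -/
theorem eventually_norm_le_exp_of_hasDerivAt {A : 𝔸} {f : ℝ → 𝔸} (h1 : ‖(1 : 𝔸)‖ ≤ 1)
    (hd : HasDerivAt f A 0) (h0 : f 0 = 1) :
    ∀ᶠ s in 𝓝[>] (0 : ℝ), ‖f s‖ ≤ Real.exp (s * (‖A‖ + 1)) := by
  have h := (hasDerivAt_iff_isLittleO.1 hd).def zero_lt_one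
  filter_upwards [nhdsWithin_le_nhds h, self_mem_nhdsWithin] with s hs hs0
  have hs0' : (0 : ℝ) < s := hs0
  simp only [h0, sub_zero, one_mul, Real.norm_eq_abs, abs_of_pos hs0'] at hs
  have : f s = (f s - 1 - s • A) + (1 + s • A) := by abel
  calc ‖f s‖ ≤ ‖f s - 1 - s • A‖ + (‖(1 : 𝔸)‖ + ‖s • A‖) := by
        conv_lhs => rw [this]
        exact (norm_add_le _ _).trans (add_le_add le_rfl (norm_add_le _ _))
    _ ≤ s + (1 + s * ‖A‖) := by
        rw [norm_smul, Real.norm_eq_abs, abs_of_pos hs0']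
        gcongr
    _ = s * (‖A‖ + 1) + 1 := by ring
    _ ≤ _ := Real.add_one_le_exp _

/-- A curve through the identity with derivative `A` generates `exp A` by iteration; hence `exp A`
lies in every closed subsemiring containing the curve. -/
theorem exp_mem_of_hasDerivAt [CompleteSpace 𝔸] (h1 : ‖(1 : 𝔸)‖ ≤ 1) (C : Subsemiring 𝔸)
    (hC : IsClosed (C : Set 𝔸)) {A : 𝔸} {f : ℝ → 𝔸} (hd : HasDerivAt f A 0) (h0 : f 0 = 1)
    (hm : ∀ s, 0 ≤ s → f s ∈ C) : NormedSpace.exp A ∈ C := by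
  let _ : NormedAlgebra ℚ 𝔸 := NormedAlgebra.restrictScalars ℚ ℝ 𝔸
  have hg : HasDerivAt (fun s : ℝ => NormedSpace.exp (s • A)) A 0 := by
    have h := hasDerivAt_exp_smul_const (𝕂 := ℝ) A (0 : ℝ)
    rwa [zero_smul, NormedSpace.exp_zero, one_mul] at h
  have hu : Tendsto (fun n : ℕ => ((n : ℝ) + 1)⁻¹) atTop (𝓝[>] (0 : ℝ)) := by
    refine tendsto_nhdsWithin_iff.2 ⟨?_, Eventually.of_forall fun n => ?_⟩
    · simpa using tendsto_one_div_add_atTop_nhds_zero_nat (𝕜 := ℝ)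
    · exact inv_pos.2 (n.cast_add_one_pos (α := ℝ))
  have e1 := hu.eventually (eventually_norm_le_exp_of_hasDerivAt h1 hd h0)
  have e2 := hu.eventually (eventually_norm_le_exp_of_hasDerivAt h1 hg (by simp))
  -- Both curves have the same value and derivative at 0, so they differ by o(s); n + 1 telescoped
  -- errors at s = 1/(n+1) then tend to 0.
  have hdiff : (fun s => f s - NormedSpace.exp (s • A)) =o[𝓝[>] (0 : ℝ)] fun s : ℝ => s := by
    have := hasDerivAt_iff_isLittleO.1 (hd.sub hg)
    simp only [Pi.sub_apply, h0, zero_smul, NormedSpace.exp_zero, sub_self, sub_zero, smul_zero] at this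
    exact this.mono nhdsWithin_le_nhds
  have hlim : Tendsto (fun n : ℕ => f ((n : ℝ) + 1)⁻¹ ^ (n + 1)) atTop
      (𝓝 (NormedSpace.exp A)) := by
    rw [tendsto_iff_norm_sub_tendsto_zero]
    rw [Metric.tendsto_atTop']
    simp only [dist_zero_right, norm_norm]
    intro δ hδ
    set c := Real.exp (‖A‖ + 1) with hc
    have hc0 : 0 < c := Real.exp_pos _
    have e3 := hu.eventually (hdiff.def (c := δ / (2 * c)) (by positivity))
    obtain ⟨N, hN⟩ := eventually_atTop.1 (e1.and (e2.and e3))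
    refine ⟨N, fun n hn => ?_⟩
    obtain ⟨a1, a2, a3⟩ := hN n hn.le
    have hn1 : (0 : ℝ) < (n : ℝ) + 1 := by positivity
    have hexp : NormedSpace.exp A = NormedSpace.exp (((n : ℝ) + 1)⁻¹ • A) ^ (n + 1) := by
      rw [← NormedSpace.exp_nsmul, ← Nat.cast_smul_eq_nsmul ℝ, smul_smul]
      push_cast
      rw [mul_inv_cancel₀ hn1.ne', one_smul]
    rw [hexp]
    have hM : (1 : ℝ) ≤ Real.exp (((n : ℝ) + 1)⁻¹ * (‖A‖ + 1)) :=
      Real.one_le_exp (by positivity)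
    refine (norm_pow_sub_pow_le_mul h1 hM a1 a2 (n + 1)).trans_lt ?_
    have hMn : Real.exp (((n : ℝ) + 1)⁻¹ * (‖A‖ + 1)) ^ (n + 1) = c := by
      rw [← Real.exp_nat_mul, hc]
      congr 1
      push_cast
      field_simp
    rw [hMn]
    rw [Real.norm_eq_abs, abs_of_pos (inv_pos.2 hn1)] at a3
    calc ((n + 1 : ℕ) : ℝ) * c * _ ≤ ((n + 1 : ℕ) : ℝ) * c * (δ / (2 * c) * ((n : ℝ) + 1)⁻¹) := by
          gcongr
      _ = δ / 2 := by push_cast; field_simp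
      _ < δ := half_lt_self hδ
  exact hC.mem_of_tendsto hlim (Eventually.of_forall fun n =>
    C.pow_mem (hm _ (inv_nonneg.2 (by positivity))) _)

/-- The term in Q leaves the derivative at 0 unchanged; it is there to complete a square. -/
theorem exp_mem_of_one_add_smul_add_sq_smul_mem {𝔸 : Type*} [NormedRing 𝔸] [NormedAlgebra ℂ 𝔸]
    [CompleteSpace 𝔸] (h1 : ‖(1 : 𝔸)‖ ≤ 1) (C : Subsemiring 𝔸) (hC : IsClosed (C : Set 𝔸))
    {A Q : 𝔸} (hm : ∀ s : ℝ, 0 ≤ s → 1 + (s : ℂ) • A + (s : ℂ) ^ 2 • Q ∈ C) :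
    NormedSpace.exp A ∈ C := by
  refine exp_mem_of_hasDerivAt h1 C hC (f := fun s : ℝ => 1 + (s : ℂ) • A + (s : ℂ) ^ 2 • Q)
    ?_ (by simp) hm
  have e1 := ((hasDerivAt_id (0 : ℝ)).smul_const A).const_add 1
  have e2 := ((hasDerivAt_id (0 : ℝ)).fun_pow 2).smul_const Q
  have e3 := e1.fun_add e2
  simp only [← Complex.ofReal_pow, Complex.coe_smul]
  simpa using e3

end ProductFormula

/-! ### Complete positivity of the semigroup -/

section CompletePositivity

variable {B : Type*} [NormedRing B] [NormedAlgebra ℂ B] [StarRing B]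

/-- The completely positive map `x ↦ a^* x a`. -/
noncomputable def conjMap (a : B) : B →L[ℂ] B :=
  (ContinuousLinearMap.mul ℂ B).flip a ∘L ContinuousLinearMap.mul ℂ B (star a)

theorem conjMap_apply (a x : B) : conjMap a x = star a * x * a := rfl

/-- The closed cone generated by the maps `x ↦ a^* x a`. -/
noncomputable def cpCone (B : Type*) [NormedRing B] [NormedAlgebra ℂ B] [StarRing B] :
    Subsemiring (B →L[ℂ] B) :=
  (Subsemiring.closure (Set.range conjMap)).topologicalClosure

theorem conjMap_mem_cpCone (a : B) : conjMap a ∈ cpCone B :=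
  Subsemiring.le_topologicalClosure _ (Subsemiring.subset_closure ⟨a, rfl⟩)

theorem smul_conjMap [StarModule ℂ B] {s : ℝ} (hs : 0 ≤ s) (a : B) :
    (s : ℂ) • conjMap a = conjMap (((√s : ℝ) : ℂ) • a) := by
  ext1 x
  have h : (s : ℂ) = ((√s : ℝ) : ℂ) * ((√s : ℝ) : ℂ) := by
    rw [← Complex.ofReal_mul, Real.mul_self_sqrt hs]
  simp only [smul_apply, conjMap_apply, star_smul, smul_mul_assoc,
    mul_smul_comm, smul_smul]
  rw [h]
  simp

/-- Finite sums of maps `x ↦ a^* x a` are stable under composition, so a property of such maps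
that is additive, closed and holds for each of them holds on the cone. -/
theorem cpCone_induction {P : (B →L[ℂ] B) → Prop}
    (hclosed : IsClosed {T | P T}) (h0 : P 0) (hadd : ∀ S T, P S → P T → P (S + T))
    (hconj : ∀ a, P (conjMap a)) {T : B →L[ℂ] B} (hT : T ∈ cpCone B) :
    P T := by
  have hmem : ∀ T ∈ Subsemiring.closure (Set.range (conjMap (B := B))), P T := by
    intro T hT
    rw [Subsemiring.mem_closure_iff] at hT
    induction hT using AddSubmonoid.closure_induction with
    | zero => exact h0
    | add S T _ _ hS hT => exact hadd S T hS hT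
    | mem T hT =>
      suffices ∃ a, conjMap a = T by
        obtain ⟨a, rfl⟩ := this
        exact hconj a
      induction hT using Submonoid.closure_induction with
      | one => exact ⟨1, by ext1 x; simp [conjMap_apply]⟩
      | mem T hT => exact hT
      | mul S T _ _ hS hT =>
        obtain ⟨a, rfl⟩ := hS
        obtain ⟨b, rfl⟩ := hT
        exact ⟨b * a, by ext1 x; simp [conjMap_apply, mul_assoc]⟩
  exact hclosed.closure_subset_iff.2 hmem hT

/-- The semigroup generated by `x ↦ K^* x + x K + ∑ i, c i • (W i)^* x (W i)`, with `c i ≥ 0`, is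
completely positive. -/
theorem expSemigroup_mem_cpCone [CompleteSpace B] [StarModule ℂ B] {ι : Type*} (F : Finset ι)
    (c : ι → ℝ) (hc : ∀ i ∈ F, 0 ≤ c i) (W : ι → B) (K : B) (L : B →L[ℂ] B)
    (hL : ∀ x, L x = star K * x + x * K + ∑ i ∈ F, (c i : ℂ) • conjMap (W i) x) {t : ℝ}
    (ht : 0 ≤ t) : expSemigroup L t ∈ cpCone B := by
  refine exp_mem_of_one_add_smul_add_sq_smul_mem (Q := (t : ℂ) ^ 2 • conjMap K)
    ContinuousLinearMap.norm_id_le _ (Subsemiring.isClosed_topologicalClosure _) fun s hs => ?_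
  -- The quadratic term completes 1 + st(K^* x + x K) to the single map x ↦ (1 + stK)^* x (1 + stK).
  have e : 1 + (s : ℂ) • ((t : ℂ) • L) + (s : ℂ) ^ 2 • ((t : ℂ) ^ 2 • conjMap K) =
      conjMap (1 + ((s * t : ℝ) : ℂ) • K)
        + ∑ i ∈ F, ((s * t * c i : ℝ) : ℂ) • conjMap (W i) := by
    ext1 x
    have hr : star ((s : ℂ) * t) = (s : ℂ) * t := by simp
    simp only [add_apply, smul_apply, conjMap_apply, hL,
      one_apply_eq_self, sum_apply, star_add, star_one, star_smul, hr,
      mul_add, add_mul, one_mul, mul_one, smul_mul_assoc, mul_smul_comm, smul_add,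
      Finset.smul_sum, smul_smul, mul_assoc, Complex.ofReal_mul]
    module
  rw [e]
  refine add_mem (conjMap_mem_cpCone _) (sum_mem fun i hi => ?_)
  rw [smul_conjMap (mul_nonneg (mul_nonneg hs ht) (hc i hi))]
  exact conjMap_mem_cpCone _

end CompletePositivity

/-! ### Traces, square roots and transposes in the basis -/

section Entries

variable {E : Type*} [NormedAddCommGroup E] [InnerProductSpace ℂ E]
  {d : ℕ} (e : OrthonormalBasis (Fin d) ℂ E)

theorem tr_eq_sum_inner (x : E →L[ℂ] E) : tr x = ∑ i, ⟪e i, x (e i)⟫_ℂ :=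
  LinearMap.trace_eq_sum_inner _ e

theorem tr_mul_comm (x y : E →L[ℂ] E) : tr (x * y) = tr (y * x) :=
  LinearMap.trace_mul_comm ℂ (x : E →ₗ[ℂ] E) (y : E →ₗ[ℂ] E)

theorem tr_add (x y : E →L[ℂ] E) : tr (x + y) = tr x + tr y :=
  map_add (LinearMap.trace ℂ E) (x : E →ₗ[ℂ] E) (y : E →ₗ[ℂ] E)

theorem tr_sub (x y : E →L[ℂ] E) : tr (x - y) = tr x - tr y :=
  map_sub (LinearMap.trace ℂ E) (x : E →ₗ[ℂ] E) (y : E →ₗ[ℂ] E)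

theorem tr_smul (c : ℂ) (x : E →L[ℂ] E) : tr (c • x) = c * tr x :=
  map_smul (LinearMap.trace ℂ E) c (x : E →ₗ[ℂ] E)

theorem tr_zero : tr (0 : E →L[ℂ] E) = 0 := map_zero (LinearMap.trace ℂ E)

theorem tr_mul_rankOne [FiniteDimensional ℂ E] (x : E →L[ℂ] E) (u v : E) :
    tr (x * InnerProductSpace.rankOne ℂ u v) = ⟪v, x u⟫_ℂ := by
  have : x * InnerProductSpace.rankOne ℂ u v = InnerProductSpace.rankOne ℂ (x u) v := by
    ext z; simp
  rw [this]
  exact InnerProductSpace.trace_rankOne _ _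

include e in
theorem ext_inner_basis {x y : E →L[ℂ] E} (h : ∀ i j, ⟪e i, x (e j)⟫_ℂ = ⟪e i, y (e j)⟫_ℂ) :
    x = y := by
  refine ContinuousLinearMap.coe_injective (e.toBasis.ext fun j => ?_)
  refine e.repr.injective (PiLp.ext fun i => ?_)
  simpa [OrthonormalBasis.repr_apply_apply] using h i j

theorem eq_zero_of_tr_mul_eq_zero [FiniteDimensional ℂ E] {x : E →L[ℂ] E}
    (h : ∀ y, tr (x * y) = 0) : x = 0 := by
  ext u
  refine ext_inner_left ℂ fun v => ?_
  rw [← tr_mul_rankOne, h]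
  simp

theorem inner_mul_apply (x y : E →L[ℂ] E) (i j : Fin d) :
    ⟪e i, (x * y) (e j)⟫_ℂ = ∑ k, ⟪e i, x (e k)⟫_ℂ * ⟪e k, y (e j)⟫_ℂ := by
  conv_lhs => rw [mul_apply_eq_comp, ← e.sum_repr' (y (e j)), map_sum, inner_sum]
  simp only [map_smul, inner_smul_right]
  exact Finset.sum_congr rfl fun k _ => mul_comm _ _

section SquareRoot

variable [CompleteSpace E]

theorem inner_star_apply (x : E →L[ℂ] E) (u v : E) :
    ⟪u, star x v⟫_ℂ = starRingEnd ℂ ⟪v, x u⟫_ℂ := by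
  rw [ContinuousLinearMap.star_eq_adjoint, ContinuousLinearMap.adjoint_inner_right, inner_conj_symm]

variable {ρ : E →L[ℂ] E} {p : Fin d → ℝ} (hp : ∀ j, 0 < p j)
  (hρe : ∀ j, ρ (e j) = (p j : ℂ) • e j)

include e hp hρe in
-- Uniqueness of the nonnegative square root identifies this diagonal operator with `CFC.sqrt ρ`.
theorem exists_sqrt_diag : ∃ R : E →L[ℂ] E, 0 ≤ R ∧ R * R = ρ ∧
    ∀ j, R (e j) = ((√(p j) : ℝ) : ℂ) • e j := by
  have key : ∀ j, (∑ k, ((√(p k) : ℝ) : ℂ) • InnerProductSpace.rankOne ℂ (e k) (e k)) (e j)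
      = ((√(p j) : ℝ) : ℂ) • e j := by
    intro j
    simp [sum_apply, OrthonormalBasis.inner_eq_ite]
  refine ⟨_, ?_, ?_, key⟩
  · refine Finset.sum_nonneg fun k _ => ?_
    rw [ContinuousLinearMap.nonneg_iff_isPositive]
    exact (InnerProductSpace.isPositive_rankOne_self _).smul_of_nonneg
      (by exact_mod_cast Real.sqrt_nonneg _)
  · refine ContinuousLinearMap.coe_injective (e.toBasis.ext fun j => ?_)
    simp only [ContinuousLinearMap.coe_coe, OrthonormalBasis.coe_toBasis,
      mul_apply_eq_comp]
    rw [key, map_smul, key, smul_smul, hρe, ← Complex.ofReal_mul, Real.mul_self_sqrt (hp j).le]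

include hp hρe in
theorem sqrt_apply_basis (j : Fin d) : CFC.sqrt ρ (e j) = ((√(p j) : ℝ) : ℂ) • e j := by
  obtain ⟨R, hR, hRR, hRe⟩ := exists_sqrt_diag e hp hρe
  rw [CFC.sqrt_unique hRR hR, hRe]

include e hp hρe in
theorem sqrt_mul_sqrt_self : CFC.sqrt ρ * CFC.sqrt ρ = ρ := by
  obtain ⟨R, hR, hRR, hRe⟩ := exists_sqrt_diag e hp hρe
  rw [CFC.sqrt_unique hRR hR, hRR]

theorem star_sqrt (ρ : E →L[ℂ] E) : star (CFC.sqrt ρ) = CFC.sqrt ρ :=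
  (IsSelfAdjoint.of_nonneg (CFC.sqrt_nonneg ρ)).star_eq

include hp hρe in
theorem inner_mul_sqrt (x : E →L[ℂ] E) (i j : Fin d) :
    ⟪e i, (x * CFC.sqrt ρ) (e j)⟫_ℂ = ((√(p j) : ℝ) : ℂ) * ⟪e i, x (e j)⟫_ℂ := by
  rw [mul_apply_eq_comp, sqrt_apply_basis e hp hρe, map_smul, inner_smul_right]

include hp hρe in
theorem inner_sqrt_mul (x : E →L[ℂ] E) (i j : Fin d) :
    ⟪e i, (CFC.sqrt ρ * x) (e j)⟫_ℂ = ((√(p i) : ℝ) : ℂ) * ⟪e i, x (e j)⟫_ℂ := by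
  rw [mul_apply_eq_comp, ← star_sqrt ρ, ContinuousLinearMap.star_eq_adjoint,
    ContinuousLinearMap.adjoint_inner_right, sqrt_apply_basis e hp hρe, inner_smul_left,
    Complex.conj_ofReal]

include hp hρe in
/-- An operator commuting with the faithful diagonal `ρ` commutes with its square root. -/
theorem sqrt_mul_eq_mul_sqrt {x : E →L[ℂ] E} (hx : ρ * x = x * ρ) :
    CFC.sqrt ρ * x = x * CFC.sqrt ρ := by
  refine ext_inner_basis e fun i j => ?_
  rw [inner_sqrt_mul e hp hρe, inner_mul_sqrt e hp hρe]
  have h : ⟪e i, (ρ * x) (e j)⟫_ℂ = ⟪e i, (x * ρ) (e j)⟫_ℂ := by rw [hx]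
  rw [← sqrt_mul_sqrt_self e hp hρe, mul_assoc, ← mul_assoc x, inner_sqrt_mul e hp hρe,
    inner_sqrt_mul e hp hρe, inner_mul_sqrt e hp hρe, inner_mul_sqrt e hp hρe, ← mul_assoc,
    ← mul_assoc, ← Complex.ofReal_mul, ← Complex.ofReal_mul, Real.mul_self_sqrt (hp i).le,
    Real.mul_self_sqrt (hp j).le] at h
  -- Entrywise, commutation reads p_i x_ij = p_j x_ij: either p_i = p_j or the entry vanishes.
  rcases mul_eq_mul_right_iff.1 h with h | h
  · rw [Complex.ofReal_injective h]
  · rw [h, mul_zero, mul_zero]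

end SquareRoot

section Transposition

variable [FiniteDimensional ℂ E]

theorem inner_transposeOp (x : E →L[ℂ] E) (i j : Fin d) :
    ⟪e i, transposeOp e x (e j)⟫_ℂ = ⟪e j, x (e i)⟫_ℂ := by
  have : transposeOp e x (e j) = ∑ k, ⟪e j, x (e k)⟫_ℂ • e k := by
    have h := Matrix.toLin_self e.toBasis e.toBasis
      (LinearMap.toMatrix e.toBasis e.toBasis (x : E →ₗ[ℂ] E)).transpose j
    simp only [OrthonormalBasis.coe_toBasis, Matrix.transpose_apply, LinearMap.toMatrix_apply,
      OrthonormalBasis.coe_toBasis_repr_apply, OrthonormalBasis.repr_apply_apply] at h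
    exact h
  rw [this, inner_sum]
  simp [inner_smul_right, OrthonormalBasis.inner_eq_ite]

theorem transposeOp_transposeOp (x : E →L[ℂ] E) : transposeOp e (transposeOp e x) = x :=
  ext_inner_basis e fun i j => by rw [inner_transposeOp, inner_transposeOp]

theorem transposeOp_add (x y : E →L[ℂ] E) :
    transposeOp e (x + y) = transposeOp e x + transposeOp e y :=
  ext_inner_basis e fun i j => by
    simp only [inner_transposeOp, add_apply, inner_add_right]

theorem transposeOp_smul (c : ℂ) (x : E →L[ℂ] E) :
    transposeOp e (c • x) = c • transposeOp e x :=
  ext_inner_basis e fun i j => by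
    simp only [inner_transposeOp, smul_apply, inner_smul_right]

theorem transposeOp_mul (x y : E →L[ℂ] E) :
    transposeOp e (x * y) = transposeOp e y * transposeOp e x :=
  ext_inner_basis e fun i j => by
    simp only [inner_transposeOp, inner_mul_apply]
    exact Finset.sum_congr rfl fun k _ => mul_comm _ _

theorem tr_transposeOp (x : E →L[ℂ] E) : tr (transposeOp e x) = tr x := by
  simp only [tr_eq_sum_inner e, inner_transposeOp]

theorem transposeOp_rankOne (i j : Fin d) :
    transposeOp e (InnerProductSpace.rankOne ℂ (e i) (e j)) =
      InnerProductSpace.rankOne ℂ (e j) (e i) :=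
  ext_inner_basis e fun k l => by
    simp only [inner_transposeOp, InnerProductSpace.rankOne_apply, inner_smul_right,
      OrthonormalBasis.inner_eq_ite]
    split_ifs <;> simp_all

/-- Transposition as a continuous linear map. -/
noncomputable def transposeCLM : (E →L[ℂ] E) →L[ℂ] (E →L[ℂ] E) :=
  LinearMap.toContinuousLinearMap
    { toFun := transposeOp e
      map_add' := transposeOp_add e
      map_smul' := transposeOp_smul e }

theorem transposeCLM_apply (x : E →L[ℂ] E) : transposeCLM e x = transposeOp e x := rfl

variable [CompleteSpace E]

/-- This is how the reality assumption acts: Θ turns V_ω into V_ω^* and fixes H_ω. -/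
theorem transposeOp_eq_star {x : E →L[ℂ] E} (hx : IsRealMatrix e x) : transposeOp e x = star x :=
  ext_inner_basis e fun i j => by
    rw [inner_transposeOp, inner_star_apply, Complex.conj_eq_iff_im.2 (hx j i)]

theorem transposeOp_star_eq {x : E →L[ℂ] E} (hx : IsRealMatrix e x) :
    transposeOp e (star x) = x := by
  rw [← transposeOp_eq_star e hx, transposeOp_transposeOp]

theorem transposeOp_sqrt {ρ : E →L[ℂ] E} {p : Fin d → ℝ} (hp : ∀ j, 0 < p j)
    (hρe : ∀ j, ρ (e j) = (p j : ℂ) • e j) : transposeOp e (CFC.sqrt ρ) = CFC.sqrt ρ := by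
  rw [transposeOp_eq_star, star_sqrt]
  intro i j
  rw [sqrt_apply_basis e hp hρe, inner_smul_right, OrthonormalBasis.inner_eq_ite]
  split_ifs <;> simp

end Transposition

end Entries

/-! ### Matrix entries of the Bohr components -/

section Bohr

variable {E : Type*} [NormedAddCommGroup E] [InnerProductSpace ℂ E] [FiniteDimensional ℂ E]
  {d : ℕ} (e : OrthonormalBasis (Fin d) ℂ E)
  {HS : E →L[ℂ] E} {ε : Fin d → ℝ} (hHSe : ∀ j, HS (e j) = (ε j : ℂ) • e j)

theorem pos_of_mem_bohrFrequencies {ω : ℝ} (h : ω ∈ bohrFrequencies HS) : 0 < ω := by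
  simp only [bohrFrequencies, Finset.mem_image, Finset.mem_filter] at h
  obtain ⟨q, ⟨_, h⟩, rfl⟩ := h
  exact sub_pos.2 h

variable [CompleteSpace E]

include hHSe in
theorem spectralProj_apply_of_ne (hHS : IsSelfAdjoint HS) {c : ℝ} {j : Fin d} (h : ε j ≠ c) :
    spectralProj HS c (e j) = 0 := by
  rw [spectralProj, Submodule.starProjection_apply_eq_zero_iff, Submodule.mem_orthogonal]
  intro u hu
  have hu' : HS u = (c : ℂ) • u := Module.End.mem_eigenspace_iff.1 hu
  have h1 : ⟪HS u, e j⟫_ℂ = ⟪u, HS (e j)⟫_ℂ := hHS.isSymmetric u (e j)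
  rw [hu', hHSe, inner_smul_left, inner_smul_right, Complex.conj_ofReal] at h1
  rcases mul_eq_mul_right_iff.1 h1 with h2 | h2
  · exact absurd (Complex.ofReal_injective h2).symm h
  · exact h2

include hHSe in
-- V_ω lowers the energy by exactly ω, because e_i and e_j are orthogonal to every eigenspace but
-- their own.
theorem inner_bohrComponent_eq_zero (hHS : IsSelfAdjoint HS) (V : E →L[ℂ] E) {ω : ℝ}
    {i j : Fin d} (h : ε j - ε i ≠ ω) : ⟪e i, bohrComponent HS V ω (e j)⟫_ℂ = 0 := by
  rw [bohrComponent, sum_apply, inner_sum]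
  refine Finset.sum_eq_zero fun q hq => ?_
  rw [mul_apply_eq_comp, mul_apply_eq_comp]
  by_cases h1 : ε j = q.1
  · have h2 : ε i ≠ q.2 := by
      rintro h2
      exact h (by rw [h1, h2]; exact (Finset.mem_filter.1 hq).2)
    have h3 := spectralProj_apply_of_ne e hHSe hHS h2
    rw [spectralProj] at h3 ⊢
    rw [← Submodule.inner_starProjection_left_eq_right, h3, inner_zero_left]
  · rw [spectralProj_apply_of_ne e hHSe hHS h1, map_zero, map_zero, inner_zero_right]

end Bohr

/-! ### Derivative and symmetry of semigroups -/

section Semigroups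

variable {B : Type*} [NormedAddCommGroup B] [NormedSpace ℂ B]

theorem hasDerivAt_expSemigroup [CompleteSpace B] (L : B →L[ℂ] B) (φ : B →L[ℂ] ℂ) (x : B) :
    HasDerivAt (fun t : ℝ => φ (expSemigroup L t x)) (φ (L x)) 0 := by
  have h1 : HasDerivAt (fun t : ℝ => NormedSpace.exp (t • L)) L 0 := by
    have h := hasDerivAt_exp_smul_const (𝕂 := ℝ) L (0 : ℝ)
    rwa [zero_smul, NormedSpace.exp_zero, one_mul] at h
  exact ((φ ∘L ContinuousLinearMap.apply ℂ B x).restrictScalars ℝ).hasFDerivAt.comp_hasDerivAt 0 h1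

theorem expSemigroup_zero (L : B →L[ℂ] B) : expSemigroup L 0 = 1 := by
  rw [expSemigroup, Complex.ofReal_zero, zero_smul, NormedSpace.exp_zero]

/-- A semigroup is symmetric for a bilinear form if its generator is. -/
theorem expSemigroup_symmetric [FiniteDimensional ℂ B] (β : B →ₗ[ℂ] B →ₗ[ℂ] ℂ) (L : B →L[ℂ] B)
    (h : ∀ x y, β x (L y) = β (L x) y) (t : ℝ) (x y : B) :
    β x (expSemigroup L t y) = β (expSemigroup L t x) y := by
  have : CompleteSpace B := FiniteDimensional.complete ℂ B
  set A := (t : ℂ) • L with hA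
  have hAs : ∀ x y, β x (A y) = β (A x) y := fun x y => by
    simp only [hA, smul_apply, map_smul, LinearMap.smul_apply, h]
  have hpow : ∀ (n : ℕ) x y, β x ((A ^ n) y) = β ((A ^ n) x) y := by
    intro n
    induction n with
    | zero => intro x y; simp
    | succ n ih =>
      intro x y
      rw [pow_succ, mul_apply_eq_comp, ih, hAs, ← mul_apply_eq_comp, ← pow_succ', ← pow_succ]
  have hs := NormedSpace.exp_series_hasSum_exp' (𝕂 := ℂ) A
  have h1 := hs.mapL (LinearMap.toContinuousLinearMap (β x) ∘L ContinuousLinearMap.apply ℂ B y)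
  have h2 := hs.mapL (LinearMap.toContinuousLinearMap (β.flip y) ∘L ContinuousLinearMap.apply ℂ B x)
  refine (h1.congr_fun fun n => ?_).unique h2
  rw [map_smul, map_smul]
  exact congrArg _ (hpow n x y).symm

end Semigroups

/-! ### From vanishing entropy rate to equal slopes -/

section Limits

/-- Dividing by t turns the bound into one on (√(f/t) - √(g/t))², which tends to (√f' - √g')².
Square roots make a bound of order o(t) detect first-order terms. -/
theorem eq_of_sq_sqrt_sub_sqrt_le {f g : ℝ → ℝ} {f' g' : ℝ} (hf : HasDerivAt f f' 0)
    (hg : HasDerivAt g g' 0) (hf0 : f 0 = 0) (hg0 : g 0 = 0)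
    (hfn : ∀ t, 0 < t → 0 ≤ f t) (hgn : ∀ t, 0 < t → 0 ≤ g t)
    (h : ∀ δ : ℝ, 0 < δ → ∀ᶠ t in 𝓝[>] (0 : ℝ), (√(f t) - √(g t)) ^ 2 ≤ δ * t) : f' = g' := by
  have slope : ∀ {k : ℝ → ℝ} {k' : ℝ}, HasDerivAt k k' 0 → k 0 = 0 →
      Tendsto (fun t => k t / t) (𝓝[>] 0) (𝓝 k') := by
    intro k k' hk hk0
    have h1 := (hasDerivAt_iff_tendsto_slope.1 hk).mono_left
      (nhdsWithin_mono 0 (fun t (ht : 0 < t) => ht.ne'))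
    refine h1.congr fun t => ?_
    rw [slope_def_field, hk0, sub_zero, sub_zero]
  have sf := slope hf hf0
  have sg := slope hg hg0
  have hf' : 0 ≤ f' := ge_of_tendsto sf (by
    filter_upwards [self_mem_nhdsWithin] with t (ht : 0 < t)
    exact div_nonneg (hfn t ht) ht.le)
  have hg' : 0 ≤ g' := ge_of_tendsto sg (by
    filter_upwards [self_mem_nhdsWithin] with t (ht : 0 < t)
    exact div_nonneg (hgn t ht) ht.le)
  have hlim : Tendsto (fun t => (√(f t / t) - √(g t / t)) ^ 2) (𝓝[>] 0)
      (𝓝 ((√f' - √g') ^ 2)) :=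
    (((Real.continuous_sqrt.tendsto _).comp sf).sub
      ((Real.continuous_sqrt.tendsto _).comp sg)).pow 2
  have hle : ∀ δ : ℝ, 0 < δ → (√f' - √g') ^ 2 ≤ δ := by
    intro δ hδ
    refine le_of_tendsto hlim ?_
    filter_upwards [h δ hδ, self_mem_nhdsWithin] with t ht (ht0 : 0 < t)
    rw [Real.sqrt_div' _ ht0.le, Real.sqrt_div' _ ht0.le, ← sub_div, div_pow,
      Real.sq_sqrt ht0.le, div_le_iff₀ ht0]
    exact ht
  have hz : (√f' - √g') ^ 2 = 0 :=
    le_antisymm (le_of_forall_pos_le_add fun δ hδ => by simpa using hle δ hδ) (sq_nonneg _)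
  exact (Real.sqrt_inj hf' hg').1 (sub_eq_zero.1 (pow_eq_zero_iff two_ne_zero |>.1 hz))

open scoped ComplexOrder in
theorem sq_sqrt_diag_sub_le_of_relEntropy_div_lt {n : Type*} [Fintype n] [DecidableEq n]
    {A B : Matrix n n ℂ} (hA : A.PosSemidef) (hB : B.PosSemidef) (htr : A.trace = B.trace)
    {t δ : ℝ} (ht : 0 < t) (h : relEntropy A B / (t : EReal) < (δ : EReal)) (v : n) :
    (√(A v v).re - √(B v v).re) ^ 2 ≤ δ * t := by
  rw [relEntropy] at h
  split_ifs at h with hk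
  · rw [← EReal.coe_div, EReal.coe_lt_coe_iff, div_lt_iff₀ ht] at h
    exact (sq_sqrt_diag_sub_le_trace_log hA hB htr hk v).trans h.le
  -- A finite bound rules out the value ⊤, so the kernel inclusion is automatic.
  · rw [EReal.top_div_of_pos_ne_top (by exact_mod_cast ht) (EReal.coe_ne_top t)] at h
    exact absurd h not_top_lt

theorem relEntropy_self {n : Type*} [Fintype n] [DecidableEq n] (A : Matrix n n ℂ) :
    relEntropy A A = 0 := by
  rw [relEntropy, if_pos fun _ h => h, sub_self, mul_zero, Matrix.trace_zero]
  rfl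

end Limits

/-! ### The two-point form and its density matrices -/

section TwoPoint

variable {E : Type*} [NormedAddCommGroup E] [InnerProductSpace ℂ E] [FiniteDimensional ℂ E]
  [CompleteSpace E] {d : ℕ} (e : OrthonormalBasis (Fin d) ℂ E)

/-- The bilinear form `(x, y) ↦ tr (ρ^{1/2} x^⊺ ρ^{1/2} y)`. -/
noncomputable def twoPoint (ρ : E →L[ℂ] E) : (E →L[ℂ] E) →ₗ[ℂ] (E →L[ℂ] E) →ₗ[ℂ] ℂ :=
  LinearMap.mk₂ ℂ (fun x y => tr (CFC.sqrt ρ * transposeOp e x * CFC.sqrt ρ * y))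
    (fun x x' y => by simp only [transposeOp_add, mul_add, add_mul, tr_add])
    (fun c x y => by simp only [transposeOp_smul, mul_smul_comm, smul_mul_assoc, tr_smul, smul_eq_mul])
    (fun x y y' => by simp only [mul_add, tr_add])
    (fun c x y => by simp only [mul_smul_comm, tr_smul, smul_eq_mul])

theorem twoPoint_apply (ρ x y : E →L[ℂ] E) :
    twoPoint e ρ x y = tr (CFC.sqrt ρ * transposeOp e x * CFC.sqrt ρ * y) := rfl

variable {ρ : E →L[ℂ] E} {p : Fin d → ℝ} (hp : ∀ j, 0 < p j)
  (hρe : ∀ j, ρ (e j) = (p j : ℂ) • e j)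

include hp hρe in
-- The trace is invariant under transposition, and the diagonal ρ^{1/2} is its own transpose.
-- Consequently the backward density matrix is the forward one with the tensor factors exchanged.
theorem twoPoint_comm (x y : E →L[ℂ] E) : twoPoint e ρ x y = twoPoint e ρ y x := by
  rw [twoPoint_apply, twoPoint_apply, ← tr_transposeOp e]
  simp only [transposeOp_mul, transposeOp_transposeOp, transposeOp_sqrt e hp hρe]
  rw [tr_mul_comm, mul_assoc _ (CFC.sqrt ρ) x, tr_mul_comm (_ * _) (CFC.sqrt ρ * x)]
  simp only [mul_assoc]

include hp hρe in
theorem twoPoint_rankOne (i j : Fin d) (y : E →L[ℂ] E) :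
    twoPoint e ρ (InnerProductSpace.rankOne ℂ (e j) (e i)) y =
      ((√(p i) : ℝ) : ℂ) * ((√(p j) : ℝ) : ℂ) * ⟪e j, y (e i)⟫_ℂ := by
  rw [twoPoint_apply, transposeOp_rankOne, mul_assoc _ (CFC.sqrt ρ) y, mul_assoc (CFC.sqrt ρ),
    tr_mul_comm (CFC.sqrt ρ), mul_assoc _ _ (CFC.sqrt ρ), tr_mul_comm, tr_mul_rankOne,
    inner_mul_sqrt e hp hρe, inner_sqrt_mul e hp hρe, mul_assoc]

/-- The density matrix of the functional `x ⊗ y ↦ tr (ρ^{1/2} x^⊺ ρ^{1/2} T y)`. -/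
noncomputable def choiMatrix (ρ : E →L[ℂ] E) (T : (E →L[ℂ] E) →L[ℂ] (E →L[ℂ] E)) :
    Matrix (Fin d × Fin d) (Fin d × Fin d) ℂ :=
  densityMatrix e fun x y => twoPoint e ρ x (T y)

theorem choiMatrix_apply (ρ : E →L[ℂ] E) (T : (E →L[ℂ] E) →L[ℂ] (E →L[ℂ] E))
    (a b : Fin d × Fin d) :
    choiMatrix e ρ T a b = twoPoint e ρ (InnerProductSpace.rankOne ℂ (e b.1) (e a.1))
      (T (InnerProductSpace.rankOne ℂ (e b.2) (e a.2))) := rfl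

theorem densityMatrix_forwardState (ρ : E →L[ℂ] E)
    (T : ℝ → (E →L[ℂ] E) →L[ℂ] (E →L[ℂ] E)) (t : ℝ) :
    densityMatrix e (forwardState e ρ T t) = choiMatrix e ρ (T t) := rfl

include hp hρe in
theorem densityMatrix_backwardState (T : ℝ → (E →L[ℂ] E) →L[ℂ] (E →L[ℂ] E)) (t : ℝ) :
    densityMatrix e (backwardState e ρ T t) =
      (choiMatrix e ρ (T t)).submatrix Prod.swap Prod.swap := by
  ext a b
  exact twoPoint_comm e hp hρe _ _

open scoped ComplexOrder in
include hp hρe in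
-- The matrix is additive and continuous in T, and for x ↦ a^* x a it has the rank-one form v v^*.
theorem posSemidef_choiMatrix {T : (E →L[ℂ] E) →L[ℂ] (E →L[ℂ] E)}
    (hT : T ∈ cpCone (E →L[ℂ] E)) : (choiMatrix e ρ T).PosSemidef := by
  have hcont : ∀ a b, Continuous fun T => choiMatrix e ρ T a b := by
    intro a b
    have h1 := (LinearMap.toContinuousLinearMap (twoPoint e ρ
      (InnerProductSpace.rankOne ℂ (e b.1) (e a.1)))).continuous
    exact h1.comp (ContinuousLinearMap.apply ℂ (E →L[ℂ] E)
      (InnerProductSpace.rankOne ℂ (e b.2) (e a.2))).continuous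
  have hcont' : Continuous fun T => choiMatrix e ρ T := continuous_matrix hcont
  refine cpCone_induction (P := fun T => (choiMatrix e ρ T).PosSemidef) ?_ ?_ ?_ ?_ hT
  · simp only [Matrix.posSemidef_iff_dotProduct_mulVec, Set.ofPred_and, Set.ofPred_forall]
    refine IsClosed.inter ?_ (isClosed_iInter fun v => ?_)
    · exact isClosed_eq hcont'.matrix_conjTranspose hcont'
    · exact isClosed_le continuous_const
        (continuous_const.dotProduct (hcont'.matrix_mulVec continuous_const))
  · have : choiMatrix e ρ (0 : (E →L[ℂ] E) →L[ℂ] (E →L[ℂ] E)) = 0 := by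
      ext a b
      exact map_zero (twoPoint e ρ _)
    rw [this]
    exact Matrix.PosSemidef.zero
  · intro S T hS hT
    have : choiMatrix e ρ (S + T) = choiMatrix e ρ S + choiMatrix e ρ T := by
      ext a b
      exact map_add (twoPoint e ρ _) _ _
    rw [this]
    exact hS.add hT
  · intro a
    have : choiMatrix e ρ (conjMap a) =
        Matrix.vecMulVec (fun q : Fin d × Fin d => ((√(p q.1) : ℝ) : ℂ) * ⟪e q.2, a (e q.1)⟫_ℂ)
          (star fun q : Fin d × Fin d => ((√(p q.1) : ℝ) : ℂ) * ⟪e q.2, a (e q.1)⟫_ℂ) := by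
      ext q r
      rw [choiMatrix_apply, twoPoint_rankOne e hp hρe, conjMap_apply, Matrix.vecMulVec_apply,
        Pi.star_apply, mul_apply_eq_comp, mul_apply_eq_comp, InnerProductSpace.rankOne_apply,
        map_smul, inner_smul_right, inner_star_apply]
      simp only [star_mul, RCLike.star_def, Complex.conj_ofReal]
      ring
    rw [this]
    exact Matrix.posSemidef_vecMulVec_self_star _

end TwoPoint

/-! ### Structure of the generator -/

section GeneratorLemmas

variable {E : Type*} [NormedAddCommGroup E] [InnerProductSpace ℂ E] [CompleteSpace E]

theorem gksl_apply (H W : E →L[ℂ] E) (gm gp : ℝ) (x : E →L[ℂ] E) :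
    gksl H W gm gp x = Complex.I • (H * x - x * H)
      - ((gm : ℂ) / 2) • (star W * W * x - (2 : ℂ) • (star W * x * W) + x * (star W * W))
      - ((gp : ℂ) / 2) • (W * star W * x - (2 : ℂ) • (W * x * star W) + x * (W * star W)) := rfl

theorem gksl_eq_add (H W : E →L[ℂ] E) (gm gp : ℝ) (x : E →L[ℂ] E) :
    gksl H W gm gp x = Complex.I • (H * x - x * H) + gksl 0 W gm gp x := by
  simp only [gksl_apply, zero_mul, mul_zero, sub_zero, smul_zero, zero_sub]
  abel

theorem gksl_one (W : E →L[ℂ] E) (gm gp : ℝ) : gksl 0 W gm gp 1 = 0 := by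
  simp only [gksl_apply, mul_one, one_mul, sub_self, smul_zero]
  module

/-- Moving ρ^{1/2} past A^* and then past A produces reciprocal factors s/c and c/s, which cancel.
-/
theorem sqrt_mul_star_mul_self {ρ A : E →L[ℂ] E} {c s : ℝ} (hc : c ≠ 0)
    (h : (c : ℂ) • (A * CFC.sqrt ρ) = (s : ℂ) • (CFC.sqrt ρ * A)) :
    CFC.sqrt ρ * (star A * A) = star A * A * CFC.sqrt ρ := by
  have h' : (c : ℂ) • (CFC.sqrt ρ * star A) = (s : ℂ) • (star A * CFC.sqrt ρ) := by
    have := congrArg star h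
    simpa only [star_smul, star_mul, star_sqrt, RCLike.star_def, Complex.conj_ofReal] using this
  have hc' : (c : ℂ) ≠ 0 := by exact_mod_cast hc
  refine smul_right_injective _ hc' ?_
  calc (c : ℂ) • (CFC.sqrt ρ * (star A * A)) = ((c : ℂ) • (CFC.sqrt ρ * star A)) * A := by
        rw [smul_mul_assoc, mul_assoc]
    _ = star A * ((s : ℂ) • (CFC.sqrt ρ * A)) := by
        rw [h', smul_mul_assoc, mul_smul_comm, mul_assoc]
    _ = (c : ℂ) • (star A * A * CFC.sqrt ρ) := by
        rw [← h, mul_smul_comm, mul_assoc]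

variable [FiniteDimensional ℂ E]

theorem generator_apply (HS V : E →L[ℂ] E) (H : ℝ → E →L[ℂ] E) (gm gp : ℝ → ℝ) (x : E →L[ℂ] E) :
    generator HS V H gm gp x = ∑ ω ∈ bohrFrequencies HS,
      gksl (H ω) (bohrComponent HS V ω) (gm ω) (gp ω) x := by
  rw [generator, LinearMap.sum_apply]

theorem generator_eq_commutator_add (HS V : E →L[ℂ] E) (H : ℝ → E →L[ℂ] E) (gm gp : ℝ → ℝ)
    (x : E →L[ℂ] E) :
    generator HS V H gm gp x =
      Complex.I • ((∑ ω ∈ bohrFrequencies HS, H ω) * x - x * ∑ ω ∈ bohrFrequencies HS, H ω) +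
        ∑ ω ∈ bohrFrequencies HS, gksl 0 (bohrComponent HS V ω) (gm ω) (gp ω) x := by
  rw [generator_apply, Finset.sum_mul, Finset.mul_sum, ← Finset.sum_sub_distrib, Finset.smul_sum,
    ← Finset.sum_add_distrib]
  exact Finset.sum_congr rfl fun ω _ => gksl_eq_add _ _ _ _ _

/-- The Lindblad form: K = ∑ (-iH_ω - γ⁻/2 V_ω^* V_ω - γ⁺/2 V_ω V_ω^*), with the Boolean index
choosing between the jumps V_ω and V_ω^*. -/
theorem semigroup_mem_cpCone (HS V : E →L[ℂ] E) (H : ℝ → E →L[ℂ] E) (gm gp : ℝ → ℝ)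
    (hH : ∀ ω ∈ bohrFrequencies HS, IsSelfAdjoint (H ω))
    (hgm : ∀ ω ∈ bohrFrequencies HS, 0 < gm ω) (hgp : ∀ ω ∈ bohrFrequencies HS, 0 < gp ω)
    {t : ℝ} (ht : 0 ≤ t) : semigroup (generator HS V H gm gp) t ∈ cpCone (E →L[ℂ] E) := by
  set W := bohrComponent HS V with hW
  refine expSemigroup_mem_cpCone (bohrFrequencies HS ×ˢ (Finset.univ : Finset Bool))
    (fun q => if q.2 then gm q.1 else gp q.1) ?_ (fun q => if q.2 then W q.1 else star (W q.1))
    (∑ ω ∈ bohrFrequencies HS, (-(Complex.I • H ω) - ((gm ω : ℂ) / 2) • (star (W ω) * W ω)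
      - ((gp ω : ℂ) / 2) • (W ω * star (W ω)))) _ (fun x => ?_) ht
  · rintro ⟨ω, b⟩ hω
    have hω' := (Finset.mem_product.1 hω).1
    cases b
    · exact (hgp ω hω').le
    · exact (hgm ω hω').le
  · rw [Finset.sum_product, star_sum, Finset.sum_mul, Finset.mul_sum, ← Finset.sum_add_distrib,
      ← Finset.sum_add_distrib, LinearMap.coe_toContinuousLinearMap', generator_apply]
    refine Finset.sum_congr rfl fun ω hω => ?_
    have h2 : ∀ r : ℝ, star ((r : ℂ) / 2) = (r : ℂ) / 2 := fun r => by simp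
    simp only [Fintype.sum_bool, if_true, conjMap_apply, gksl_apply, star_sub, star_neg,
      star_smul, (hH ω hω).star_eq, star_mul, star_star, h2, RCLike.star_def, Complex.conj_I,
      sub_mul, mul_sub, neg_mul, mul_neg, smul_mul_assoc, mul_smul_comm, hW, smul_sub, smul_add,
      neg_smul, Bool.false_eq_true, if_false, mul_assoc]
    module

end GeneratorLemmas

/-! ### Symmetry of the generator under the balance relations -/

section Symmetry

variable {E : Type*} [NormedAddCommGroup E] [InnerProductSpace ℂ E] [FiniteDimensional ℂ E]
  [CompleteSpace E] {d : ℕ} (e : OrthonormalBasis (Fin d) ℂ E) {ρ : E →L[ℂ] E}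

theorem twoPoint_mul_left {G : E →L[ℂ] E} (hG : transposeOp e G = G)
    (hc : CFC.sqrt ρ * G = G * CFC.sqrt ρ) (x y : E →L[ℂ] E) :
    twoPoint e ρ x (G * y) = twoPoint e ρ (G * x) y := by
  rw [twoPoint_apply, twoPoint_apply, transposeOp_mul, hG]
  congr 1
  rw [← mul_assoc, mul_assoc _ _ G, hc]
  simp only [mul_assoc]

theorem twoPoint_mul_right {G : E →L[ℂ] E} (hG : transposeOp e G = G)
    (hc : CFC.sqrt ρ * G = G * CFC.sqrt ρ) (x y : E →L[ℂ] E) :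
    twoPoint e ρ x (y * G) = twoPoint e ρ (x * G) y := by
  rw [twoPoint_apply, twoPoint_apply, transposeOp_mul, hG, ← mul_assoc, tr_mul_comm]
  congr 1
  simp only [← mul_assoc, hc]

/-- A relation `c • A R = s • R A` with its adjoint moves `A · A^*` across the two-point form. -/
theorem mul_twoPoint_sandwich {A : E →L[ℂ] E} {c s : ℝ}
    (h : (c : ℂ) • (A * CFC.sqrt ρ) = (s : ℂ) • (CFC.sqrt ρ * A))
    (hA : transposeOp e A = star A) (hA' : transposeOp e (star A) = A) (x y : E →L[ℂ] E) :
    (c : ℂ) * c * twoPoint e ρ x (star A * y * A) =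
      (s : ℂ) * s * twoPoint e ρ (A * x * star A) y := by
  have h' : (c : ℂ) • (CFC.sqrt ρ * star A) = (s : ℂ) • (star A * CFC.sqrt ρ) := by
    have := congrArg star h
    simpa only [star_smul, star_mul, star_sqrt, RCLike.star_def, Complex.conj_ofReal] using this
  have e1 : (c : ℂ) * c * twoPoint e ρ x (star A * y * A) =
      tr (((c : ℂ) • (A * CFC.sqrt ρ)) * transposeOp e x * ((c : ℂ) • (CFC.sqrt ρ * star A)) * y) := by
    rw [twoPoint_apply, ← mul_assoc, tr_mul_comm]
    simp only [smul_mul_assoc, mul_smul_comm, tr_smul, mul_assoc]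
  have e2 : (s : ℂ) * s * twoPoint e ρ (A * x * star A) y =
      tr (((s : ℂ) • (CFC.sqrt ρ * A)) * transposeOp e x * ((s : ℂ) • (star A * CFC.sqrt ρ)) * y) := by
    rw [twoPoint_apply]
    simp only [transposeOp_mul, hA, hA', smul_mul_assoc, mul_smul_comm, tr_smul, mul_assoc]
  rw [e1, e2, h, h']

/-- The dissipative part is symmetric for the two-point form under the balance relation. -/
theorem twoPoint_gksl_symm {W : E →L[ℂ] E} {gm gp : ℝ} (hgm : 0 < gm) (hgp : 0 < gp)
    (hW : IsRealMatrix e W)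
    (h : ((√gp : ℝ) : ℂ) • (CFC.sqrt ρ * W) = ((√gm : ℝ) : ℂ) • (W * CFC.sqrt ρ))
    (x y : E →L[ℂ] E) :
    twoPoint e ρ x (gksl 0 W gm gp y) = twoPoint e ρ (gksl 0 W gm gp x) y := by
  have t1 := transposeOp_eq_star e hW
  have t2 := transposeOp_star_eq e hW
  have hm : (gm : ℂ) = ((√gm : ℝ) : ℂ) * ((√gm : ℝ) : ℂ) := by
    rw [← Complex.ofReal_mul, Real.mul_self_sqrt hgm.le]
  have hpp : (gp : ℂ) = ((√gp : ℝ) : ℂ) * ((√gp : ℝ) : ℂ) := by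
    rw [← Complex.ofReal_mul, Real.mul_self_sqrt hgp.le]
  have h' : ((√gp : ℝ) : ℂ) • (star W * CFC.sqrt ρ) = ((√gm : ℝ) : ℂ) • (CFC.sqrt ρ * star W) := by
    have := congrArg star h
    simpa only [star_smul, star_mul, star_sqrt, RCLike.star_def, Complex.conj_ofReal] using this
  -- Taken with A = W and A = W^*, the sandwich identity carries each jump term to the other one.
  have s1 := mul_twoPoint_sandwich e h.symm t1 t2 x y
  have s2 := mul_twoPoint_sandwich e h' (by rw [t2, star_star]) (by rw [star_star, t1]) x y
  rw [star_star] at s2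
  rw [← hm, ← hpp] at s1 s2
  have c1 := sqrt_mul_star_mul_self (Real.sqrt_pos.2 hgm).ne' h.symm
  have c2 := sqrt_mul_star_mul_self (Real.sqrt_pos.2 hgp).ne' h'
  rw [star_star] at c2
  have g1 : transposeOp e (star W * W) = star W * W := by rw [transposeOp_mul, t1, t2]
  have g2 : transposeOp e (W * star W) = W * star W := by rw [transposeOp_mul, t1, t2]
  simp only [gksl_apply, zero_mul, mul_zero, sub_zero, smul_zero, zero_sub, map_sub, map_neg,
    map_add, map_smul, LinearMap.sub_apply, LinearMap.neg_apply, LinearMap.add_apply,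
    LinearMap.smul_apply, twoPoint_mul_left e g1 c1, twoPoint_mul_left e g2 c2,
    twoPoint_mul_right e g1 c1, twoPoint_mul_right e g2 c2, smul_eq_mul]
  linear_combination s1 + s2

variable {p : Fin d → ℝ} (hp : ∀ j, 0 < p j) (hρe : ∀ j, ρ (e j) = (p j : ℂ) • e j)

/-- An invariant state annihilates the range of the generator. -/
theorem tr_mul_generator_eq_zero {L : (E →L[ℂ] E) →ₗ[ℂ] (E →L[ℂ] E)}
    (hinv : IsInvariantState (semigroup L) ρ) (x : E →L[ℂ] E) : tr (ρ * L x) = 0 := by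
  let φ : (E →L[ℂ] E) →ₗ[ℂ] ℂ :=
    { toFun := fun y => tr (ρ * y)
      map_add' := fun y z => by rw [mul_add, tr_add]
      map_smul' := fun c y => by rw [mul_smul_comm, tr_smul]; rfl }
  have h1 := (hasDerivAt_expSemigroup (LinearMap.toContinuousLinearMap L)
    (LinearMap.toContinuousLinearMap φ) x).hasDerivWithinAt (s := Set.Ici 0)
  -- Invariance is given for t ≥ 0 only, so the derivatives are compared one-sidedly.
  have h2 : HasDerivWithinAt (fun t : ℝ => LinearMap.toContinuousLinearMap φ
      (expSemigroup (LinearMap.toContinuousLinearMap L) t x)) 0 (Set.Ici 0) 0 := by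
    refine (hasDerivWithinAt_const (0 : ℝ) (Set.Ici 0) (tr (ρ * x))).congr
      (fun t ht => hinv t ht x) (hinv 0 le_rfl x)
  exact UniqueDiffWithinAt.eq_deriv _ (uniqueDiffOn_Ici (0 : ℝ) 0 Set.self_mem_Ici) h1 h2

include hp hρe in
/-- Under the balance relations, `ℒ` is symmetric for the two-point form. -/
theorem twoPoint_generator_symm {HS V : E →L[ℂ] E} {H : ℝ → E →L[ℂ] E} {gm gp : ℝ → ℝ}
    (hH : ∀ ω ∈ bohrFrequencies HS, IsSelfAdjoint (H ω))
    (hgm : ∀ ω ∈ bohrFrequencies HS, 0 < gm ω) (hgp : ∀ ω ∈ bohrFrequencies HS, 0 < gp ω)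
    (hinv : IsInvariantState (semigroup (generator HS V H gm gp)) ρ)
    (hVreal : ∀ ω ∈ bohrFrequencies HS, IsRealMatrix e (bohrComponent HS V ω))
    (hHreal : ∀ ω ∈ bohrFrequencies HS, IsRealMatrix e (H ω))
    (h : ∀ ω ∈ bohrFrequencies HS,
      ((√(gp ω) : ℝ) : ℂ) • (CFC.sqrt ρ * bohrComponent HS V ω) =
        ((√(gm ω) : ℝ) : ℂ) • (bohrComponent HS V ω * CFC.sqrt ρ))
    (x y : E →L[ℂ] E) :
    twoPoint e ρ x (generator HS V H gm gp y) = twoPoint e ρ (generator HS V H gm gp x) y := by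
  set K := ∑ ω ∈ bohrFrequencies HS, H ω with hK
  have hdiss : ∀ x y, twoPoint e ρ x
      (∑ ω ∈ bohrFrequencies HS, gksl 0 (bohrComponent HS V ω) (gm ω) (gp ω) y) =
      twoPoint e ρ
        (∑ ω ∈ bohrFrequencies HS, gksl 0 (bohrComponent HS V ω) (gm ω) (gp ω) x) y := by
    intro x y
    rw [map_sum, map_sum, LinearMap.sum_apply]
    exact Finset.sum_congr rfl fun ω hω =>
      twoPoint_gksl_symm e (hgm ω hω) (hgp ω hω) (hVreal ω hω) (h ω hω) x y
  have hone : transposeOp e (1 : E →L[ℂ] E) = 1 :=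
    ext_inner_basis e fun i j => by
      rw [inner_transposeOp, one_apply_eq_self, one_apply_eq_self,
        OrthonormalBasis.inner_eq_ite, OrthonormalBasis.inner_eq_ite]
      simp only [eq_comm]
  -- The dissipative part kills 1, so by its symmetry tr(ρ ·) vanishes on its range. Invariance then
  -- leaves tr(ρ[K, z]) = 0 for every z.
  have hρK : ρ * K = K * ρ := by
    rw [← sub_eq_zero]
    refine eq_zero_of_tr_mul_eq_zero fun z => ?_
    have h1 := tr_mul_generator_eq_zero hinv z
    have h2 := hdiss 1 z
    rw [Finset.sum_congr rfl fun ω _ => gksl_one _ _ _, Finset.sum_const_zero, map_zero,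
      LinearMap.zero_apply, twoPoint_apply, hone, mul_one, sqrt_mul_sqrt_self e hp hρe] at h2
    rw [generator_eq_commutator_add, ← hK, mul_add, tr_add, h2, add_zero, mul_smul_comm, tr_smul,
      mul_eq_zero, or_iff_right Complex.I_ne_zero, mul_sub, tr_sub, ← mul_assoc ρ z,
      tr_mul_comm _ K, ← mul_assoc, ← mul_assoc] at h1
    rw [sub_mul, tr_sub, h1]
  have hKs := sqrt_mul_eq_mul_sqrt e hp hρe hρK
  have hKt : transposeOp e K = K := by
    rw [← transposeCLM_apply, hK, map_sum]
    exact Finset.sum_congr rfl fun ω hω => by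
      rw [transposeCLM_apply, transposeOp_eq_star e (hHreal ω hω), (hH ω hω).star_eq]
  rw [generator_eq_commutator_add, generator_eq_commutator_add, ← hK]
  simp only [map_add, map_smul, map_sub, LinearMap.add_apply, LinearMap.smul_apply,
    LinearMap.sub_apply, hdiss, twoPoint_mul_left e hKt hKs, twoPoint_mul_right e hKt hKs]

end Symmetry

/-! ### Transition rates and the implications -/

section Equivalences

variable {E : Type*} [NormedAddCommGroup E] [InnerProductSpace ℂ E] [CompleteSpace E]
  {d : ℕ} (e : OrthonormalBasis (Fin d) ℂ E)

/-- Off-diagonal transition rates of a generator between basis states. -/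
theorem inner_gksl_rankOne (H W : E →L[ℂ] E) (gm gp : ℝ) {i k : Fin d} (hik : i ≠ k) :
    ⟪e i, gksl H W gm gp (InnerProductSpace.rankOne ℂ (e k) (e k)) (e i)⟫_ℂ =
      ((gm * ‖⟪e k, W (e i)⟫_ℂ‖ ^ 2 + gp * ‖⟪e i, W (e k)⟫_ℂ‖ ^ 2 : ℝ) : ℂ) := by
  have h1 : ⟪e k, e i⟫_ℂ = 0 := by rw [OrthonormalBasis.inner_eq_ite, if_neg hik.symm]
  have h2 : ⟪e i, e k⟫_ℂ = 0 := by rw [OrthonormalBasis.inner_eq_ite, if_neg hik]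
  have h3 : ⟪e k, star W (e i)⟫_ℂ = starRingEnd ℂ ⟪e i, W (e k)⟫_ℂ := inner_star_apply _ _ _
  have h4 : ⟪e i, star W (e k)⟫_ℂ = starRingEnd ℂ ⟪e k, W (e i)⟫_ℂ := inner_star_apply _ _ _
  have n1 := Complex.mul_conj' ⟪e k, W (e i)⟫_ℂ
  have n2 := Complex.mul_conj' ⟪e i, W (e k)⟫_ℂ
  rw [gksl_apply]
  simp only [add_apply, sub_apply, smul_apply, mul_apply_eq_comp,
    InnerProductSpace.rankOne_apply, map_smul, inner_add_right, inner_sub_right, inner_smul_right,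
    h1, h2, h3, h4, zero_smul, map_zero, inner_zero_right]
  push_cast
  rw [← n1, ← n2]
  simp only [mul_zero]
  ring

variable [FiniteDimensional ℂ E]

/-- Detailed balance says that the forward and the backward two-point states agree. -/
theorem sqdbTheta_iff (ρ : E →L[ℂ] E) (T : ℝ → (E →L[ℂ] E) →L[ℂ] (E →L[ℂ] E)) :
    SQDBTheta e ρ T ↔ ∀ t : ℝ, 0 ≤ t → ∀ x y : E →L[ℂ] E,
      twoPoint e ρ x (T t y) = twoPoint e ρ (T t x) y := by
  constructor
  · rintro ⟨T', hdual, hT'⟩ t ht x y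
    have h := hdual t ht (transposeOp e x) y
    rw [hT' t ht, transposeOp_transposeOp] at h
    exact h
  · intro h
    refine ⟨fun t => transposeCLM e ∘L T t ∘L transposeCLM e, fun t ht x y => ?_,
      fun t _ x => rfl⟩
    have h1 := h t ht (transposeOp e x) y
    rw [twoPoint_apply, transposeOp_transposeOp] at h1
    exact h1

theorem entropyProduction_eq_zero_of_symm {ρ : E →L[ℂ] E}
    {T : ℝ → (E →L[ℂ] E) →L[ℂ] (E →L[ℂ] E)}
    (h : ∀ t : ℝ, 0 ≤ t → ∀ x y : E →L[ℂ] E, twoPoint e ρ x (T t y) = twoPoint e ρ (T t x) y) :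
    entropyProduction e ρ T = 0 := by
  rw [entropyProduction, limsup_congr (v := fun _ => (0 : EReal)), limsup_const]
  filter_upwards [self_mem_nhdsWithin] with t (ht : 0 < t)
  have : forwardState e ρ T t = backwardState e ρ T t := by
    ext x y
    exact h t ht.le x y
  rw [this, relEntropy_self, EReal.zero_div]

variable {HS : E →L[ℂ] E} {ε : Fin d → ℝ} {ρ : E →L[ℂ] E} {p : Fin d → ℝ}

/-- Bohr frequencies are positive, so no V_ν raises the energy from ε_k to ε_i, and only V_ω lowers
it by ω. The rates g, g' are left general because the reverse transition exchanges the roles of γ⁻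
and γ⁺. -/
theorem sum_rates_eq (hHS : IsSelfAdjoint HS) (hHSe : ∀ j, HS (e j) = (ε j : ℂ) • e j)
    (V : E →L[ℂ] E) (g g' : ℝ → ℝ) {ω : ℝ} (hω : ω ∈ bohrFrequencies HS) {i k : Fin d}
    (hik : ε i - ε k = ω) :
    ∑ ν ∈ bohrFrequencies HS, (g ν * ‖⟪e k, bohrComponent HS V ν (e i)⟫_ℂ‖ ^ 2
      + g' ν * ‖⟪e i, bohrComponent HS V ν (e k)⟫_ℂ‖ ^ 2) =
      g ω * ‖⟪e k, bohrComponent HS V ω (e i)⟫_ℂ‖ ^ 2 := by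
  have hpos := pos_of_mem_bohrFrequencies hω
  have h2 : ∀ ν ∈ bohrFrequencies HS, ⟪e i, bohrComponent HS V ν (e k)⟫_ℂ = 0 := by
    intro ν hν
    refine inner_bohrComponent_eq_zero e hHSe hHS V ?_
    have := pos_of_mem_bohrFrequencies hν
    intro h
    linarith
  rw [Finset.sum_eq_single_of_mem ω hω, h2 ω hω]
  · simp
  · intro ν hν hne
    rw [h2 ν hν, inner_bohrComponent_eq_zero e hHSe hHS V (by rw [hik]; exact hne.symm)]
    simp

theorem re_inner_generator_rankOne (HS V : E →L[ℂ] E) (H : ℝ → E →L[ℂ] E) (gm gp : ℝ → ℝ)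
    {i k : Fin d} (hik : i ≠ k) :
    (⟪e i, generator HS V H gm gp (InnerProductSpace.rankOne ℂ (e k) (e k)) (e i)⟫_ℂ).re =
      ∑ ν ∈ bohrFrequencies HS, (gm ν * ‖⟪e k, bohrComponent HS V ν (e i)⟫_ℂ‖ ^ 2
        + gp ν * ‖⟪e i, bohrComponent HS V ν (e k)⟫_ℂ‖ ^ 2) := by
  rw [generator_apply, sum_apply, inner_sum, Complex.re_sum]
  refine Finset.sum_congr rfl fun ν _ => ?_
  rw [inner_gksl_rankOne e _ _ _ _ hik, Complex.ofReal_re]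

open scoped ComplexOrder in
/-- Vanishing entropy production forces detailed balance of the transition rates. -/
theorem rates_balance_of_entropyProduction_eq_zero (hp : ∀ j, 0 < p j)
    (hρe : ∀ j, ρ (e j) = (p j : ℂ) • e j) {L : (E →L[ℂ] E) →ₗ[ℂ] (E →L[ℂ] E)}
    (hcp : ∀ t : ℝ, 0 ≤ t → semigroup L t ∈ cpCone (E →L[ℂ] E))
    (hep : entropyProduction e ρ (semigroup L) = 0) {i k : Fin d} (hik : i ≠ k) :
    p i * (⟪e i, L (InnerProductSpace.rankOne ℂ (e k) (e k)) (e i)⟫_ℂ).re =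
      p k * (⟪e k, L (InnerProductSpace.rankOne ℂ (e i) (e i)) (e k)⟫_ℂ).re := by
  set T := semigroup L with hT
  have entry : ∀ (i : Fin d) (y : E →L[ℂ] E),
      (twoPoint e ρ (InnerProductSpace.rankOne ℂ (e i) (e i)) y).re =
        p i * (⟪e i, y (e i)⟫_ℂ).re := by
    intro i y
    rw [twoPoint_rankOne e hp hρe, ← Complex.ofReal_mul, Real.mul_self_sqrt (hp i).le,
      Complex.re_ofReal_mul]
  have hder : ∀ i k : Fin d, HasDerivAt (fun t : ℝ => (choiMatrix e ρ (T t) (i, k) (i, k)).re)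
      (p i * (⟪e i, L (InnerProductSpace.rankOne ℂ (e k) (e k)) (e i)⟫_ℂ).re) 0 := by
    intro i k
    have h := hasDerivAt_expSemigroup (LinearMap.toContinuousLinearMap L)
      (LinearMap.toContinuousLinearMap
        (twoPoint e ρ (InnerProductSpace.rankOne ℂ (e i) (e i))))
      (InnerProductSpace.rankOne ℂ (e k) (e k))
    have h' := Complex.reCLM.hasFDerivAt.comp_hasDerivAt (0 : ℝ) h
    rw [← entry i]
    exact h'
  -- Off-diagonal pairs start at 0, so their leading order in t is the transition rate.
  have hzero : ∀ i k : Fin d, i ≠ k → (choiMatrix e ρ (T 0) (i, k) (i, k)).re = 0 := by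
    intro i k hik
    rw [choiMatrix_apply, hT, semigroup, expSemigroup_zero, one_apply_eq_self, entry i,
      InnerProductSpace.rankOne_apply, inner_smul_right, OrthonormalBasis.inner_eq_ite,
      if_neg hik.symm]
    simp
  have hpsd := fun t (ht : 0 ≤ t) => posSemidef_choiMatrix e hp hρe (hcp t ht)
  refine eq_of_sq_sqrt_sub_sqrt_le (hder i k) (hder k i) (hzero i k hik) (hzero k i hik.symm)
    (fun t ht => (Complex.le_def.1 (hpsd t ht.le).diag_nonneg).1)
    (fun t ht => (Complex.le_def.1 (hpsd t ht.le).diag_nonneg).1) fun δ hδ => ?_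
  have hlt : limsup (fun t : ℝ => relEntropy (densityMatrix e (forwardState e ρ T t))
      (densityMatrix e (backwardState e ρ T t)) / (t : EReal)) (𝓝[>] (0 : ℝ)) < (δ : EReal) := by
    rw [entropyProduction] at hep
    rw [hep]
    exact_mod_cast hδ
  filter_upwards [eventually_lt_of_limsup_lt hlt, self_mem_nhdsWithin] with t h (ht : 0 < t)
  rw [densityMatrix_forwardState, densityMatrix_backwardState e hp hρe] at h
  refine sq_sqrt_diag_sub_le_of_relEntropy_div_lt (hpsd t ht.le)
    ((hpsd t ht.le).submatrix Prod.swap) ?_ ht h (i, k)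
  -- Exchanging the tensor factors permutes the diagonal, so both traces agree.
  exact ((Equiv.prodComm (Fin d) (Fin d)).sum_comp fun q => choiMatrix e ρ (T t) q q).symm

/-- Both rates between e_i and e_k contain the same factor |⟨e_k, V_ω e_i⟩|². Where it is nonzero it
cancels, leaving p_i γ⁻ = p_k γ⁺, whose square root is the claim for that entry. -/
theorem balance_of_entropyProduction_eq_zero (hHS : IsSelfAdjoint HS)
    (hHSe : ∀ j, HS (e j) = (ε j : ℂ) • e j) {V : E →L[ℂ] E} {H : ℝ → E →L[ℂ] E} {gm gp : ℝ → ℝ}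
    (hH : ∀ ω ∈ bohrFrequencies HS, IsSelfAdjoint (H ω))
    (hgm : ∀ ω ∈ bohrFrequencies HS, 0 < gm ω) (hgp : ∀ ω ∈ bohrFrequencies HS, 0 < gp ω)
    (hp : ∀ j, 0 < p j) (hρe : ∀ j, ρ (e j) = (p j : ℂ) • e j)
    (hep : entropyProduction e ρ (semigroup (generator HS V H gm gp)) = 0) {ω : ℝ}
    (hω : ω ∈ bohrFrequencies HS) :
    ((√(gp ω) : ℝ) : ℂ) • (CFC.sqrt ρ * bohrComponent HS V ω) =
      ((√(gm ω) : ℝ) : ℂ) • (bohrComponent HS V ω * CFC.sqrt ρ) := by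
  refine ext_inner_basis e fun k i => ?_
  rw [smul_apply, smul_apply, inner_smul_right, inner_smul_right, inner_sqrt_mul e hp hρe,
    inner_mul_sqrt e hp hρe]
  by_cases hz : ⟪e k, bohrComponent HS V ω (e i)⟫_ℂ = 0
  · rw [hz, mul_zero, mul_zero, mul_zero, mul_zero]
  have hε : ε i - ε k = ω := by
    by_contra hne
    exact hz (inner_bohrComponent_eq_zero e hHSe hHS V hne)
  have hik : i ≠ k := by
    rintro rfl
    rw [sub_self] at hε
    exact (pos_of_mem_bohrFrequencies hω).ne hε
  have hbal := rates_balance_of_entropyProduction_eq_zero e hp hρe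
    (fun t ht => semigroup_mem_cpCone HS V H gm gp hH hgm hgp ht) hep hik
  have hn : ‖⟪e k, bohrComponent HS V ω (e i)⟫_ℂ‖ ^ 2 ≠ 0 := pow_ne_zero 2 (norm_ne_zero_iff.2 hz)
  have hswap := sum_rates_eq e hHS hHSe V gp gm hω hε
  simp only [add_comm (gp _ * _)] at hswap
  rw [re_inner_generator_rankOne e HS V H gm gp hik,
    re_inner_generator_rankOne e HS V H gm gp hik.symm, sum_rates_eq e hHS hHSe V gm gp hω hε,
    hswap, ← mul_assoc, ← mul_assoc] at hbal
  have hsqrt : √(p i) * √(gm ω) = √(p k) * √(gp ω) := by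
    rw [← Real.sqrt_mul (hp i).le, ← Real.sqrt_mul (hp k).le, mul_right_cancel₀ hn hbal]
  have hsqrt' : ((√(p i) : ℝ) : ℂ) * ((√(gm ω) : ℝ) : ℂ) =
      ((√(p k) : ℝ) : ℂ) * ((√(gp ω) : ℝ) : ℂ) := by exact_mod_cast hsqrt
  linear_combination (-⟪e k, bohrComponent HS V ω (e i)⟫_ℂ) * hsqrt'

theorem semigroup_symmetric (β : (E →L[ℂ] E) →ₗ[ℂ] (E →L[ℂ] E) →ₗ[ℂ] ℂ)
    (L : (E →L[ℂ] E) →ₗ[ℂ] (E →L[ℂ] E)) (h : ∀ x y, β x (L y) = β (L x) y) (t : ℝ)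
    (x y : E →L[ℂ] E) : β x (semigroup L t y) = β (semigroup L t x) y :=
  expSemigroup_symmetric β (LinearMap.toContinuousLinearMap L) h t x y

/-- The balance relation in terms of the Kraus operators. -/
theorem sqrt_mul_star_krausOp_iff (ρ HS V : E →L[ℂ] E) (gm gp : ℝ → ℝ) (freq : ℕ → ℝ) {l : ℕ}
    (hl : 1 ≤ l) :
    CFC.sqrt ρ * star (krausOp HS V gm gp freq (2 * l - 1)) =
        krausOp HS V gm gp freq (2 * l) * CFC.sqrt ρ ↔
      ((√(gp (freq l)) : ℝ) : ℂ) • (CFC.sqrt ρ * bohrComponent HS V (freq l)) =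
        ((√(gm (freq l)) : ℝ) : ℂ) • (bohrComponent HS V (freq l) * CFC.sqrt ρ) := by
  -- The bound 1 ≤ l keeps the truncated subtraction 2l - 1 odd and makes its index halve back to l.
  have h1 : ¬ Even (2 * l - 1) := by
    rw [Nat.not_even_iff_odd]
    exact ⟨l - 1, by omega⟩
  have h2 : (2 * l - 1 + 1) / 2 = l := by omega
  have h3 : 2 * l / 2 = l := by omega
  rw [krausOp, krausOp, if_neg h1, if_pos (even_two_mul l), h2, h3, star_smul, star_star,
    RCLike.star_def, Complex.conj_ofReal, mul_smul_comm, smul_mul_assoc]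

end Equivalences

end StochLimit

open StochLimit
theorem mainTheorem3
    {E : Type*} [NormedAddCommGroup E] [InnerProductSpace ℂ E] [FiniteDimensional ℂ E]
    [CompleteSpace E] {d : ℕ}
    -- the orthonormal basis, diagonalizing both the system Hamiltonian and the state
    (e : OrthonormalBasis (Fin d) ℂ E)
    -- the system Hamiltonian
    (HS : E →L[ℂ] E) (hHS : IsSelfAdjoint HS)
    (ε : Fin d → ℝ) (hHSe : ∀ j, HS (e j) = (ε j : ℂ) • e j)
    -- the data of the generator
    (V : E →L[ℂ] E) (H : ℝ → E →L[ℂ] E) (gm gp : ℝ → ℝ)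
    (hH : ∀ ω ∈ bohrFrequencies HS, IsSelfAdjoint (H ω))
    (hHcomm : ∀ ω ∈ bohrFrequencies HS, Commute (H ω) HS)
    (hgm : ∀ ω ∈ bohrFrequencies HS, 0 < gm ω)
    (hgp : ∀ ω ∈ bohrFrequencies HS, 0 < gp ω)
    -- the faithful invariant state
    (ρ : E →L[ℂ] E) (p : Fin d → ℝ) (hp : ∀ j, 0 < p j) (hp1 : ∑ j, p j = 1)
    (hρe : ∀ j, ρ (e j) = (p j : ℂ) • e j)
    (hinv : IsInvariantState (semigroup (generator HS V H gm gp)) ρ)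
    -- an enumeration of the Bohr frequencies
    (b : ℕ) (freq : ℕ → ℝ) (hfreq : Set.BijOn freq (Set.Icc 1 b) (bohrFrequencies HS))
    -- the reality assumption
    (hVreal : ∀ ω ∈ bohrFrequencies HS, IsRealMatrix e (bohrComponent HS V ω))
    (hHreal : ∀ ω ∈ bohrFrequencies HS, IsRealMatrix e (H ω)) :
    List.TFAE [
      entropyProduction e ρ (semigroup (generator HS V H gm gp)) = 0,
      ∀ l ∈ Set.Icc 1 b,
        CFC.sqrt ρ * star (krausOp HS V gm gp freq (2 * l - 1)) =
          krausOp HS V gm gp freq (2 * l) * CFC.sqrt ρ,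
      ∀ ω ∈ bohrFrequencies HS,
        ((√(gp ω) : ℝ) : ℂ) • (CFC.sqrt ρ * bohrComponent HS V ω) =
          ((√(gm ω) : ℝ) : ℂ) • (bohrComponent HS V ω * CFC.sqrt ρ),
      SQDBTheta e ρ (semigroup (generator HS V H gm gp))] := by
  tfae_have 2 ↔ 3 := by
    constructor
    · intro h ω hω
      obtain ⟨l, hl, rfl⟩ := hfreq.surjOn hω
      exact (sqrt_mul_star_krausOp_iff ρ HS V gm gp freq hl.1).1 (h l hl)
    · intro h l hl
      exact (sqrt_mul_star_krausOp_iff ρ HS V gm gp freq hl.1).2 (h _ (hfreq.mapsTo hl))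
  tfae_have 3 → 4 := by
    intro h
    rw [sqdbTheta_iff]
    intro t _ x y
    exact semigroup_symmetric _ _
      (twoPoint_generator_symm e hp hρe hH hgm hgp hinv hVreal hHreal h) t x y
  tfae_have 4 → 1 := fun h =>
    entropyProduction_eq_zero_of_symm e ((sqdbTheta_iff e ρ _).1 h)
  tfae_have 1 → 3 := fun hep ω hω =>
    balance_of_entropyProduction_eq_zero e hHS hHSe hH hgm hgp hp hρe hep hω
  tfae_finish
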